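/- Let $n\ge 1$. Let $\mathbb S^n\subset\mathbb R^{n+1}$ be the unit sphere with the chordal distance $d(x,y)=\|x-y\|$ and the volume measure $\mu$ of the round metric, and work in the real Hilbert space $L^2(\mathbb S^n,\mu)$. Put $$\operatorname{Dom}\mathcal E=\Big\{f\in L^2(\mathbb S^n,\mu):\iint\frac{|f(x)-f(y)|^2}{d(x,y)^n}\,d\mu(y)\,d\mu(x)<\infty\Big\},$$ $$\mathcal E(f,g)=\frac12\iint\frac{(f(x)-f(y))(g(x)-g(y))}{d(x,y)^n}\,d\mu(y)\,d\mu(x)\qquad(f,g\in\operatorname{Dom}\mathcal E).$$ The logarithmic Dirichlet Laplacian $\Delta$ is the positive self-adjoint operator associated with the densely defined closed form $\mathcal E$: if, for $f\in L^2(\mathbb S^n,\mu)$, $Rf\in\operatorname{Dom}\mathcal E$ denotes the element with $\langle Rf,g\rangle_{L^2}+\mathcal E(Rf,g)=\langle f,g\rangle_{L^2}$ for all $g\in\operatorname{Dom}\mathcal E$, then $\operatorname{Dom}\Delta=R\,L^2(\mathbb S^n,\mu)$ and $\Delta Rf=f-Rf$. Let $\mathrm{SO}^+(n+1,1)$ be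 the group of real $(n+2)\times(n+2)$ matrices of determinant one that preserve the form $x_1^2+\dots+x_{n+1}^2-t^2$ and the direction of time. It acts by isometries on the unit ball of $\mathbb R^{n+1}$ with the Poincaré metric $2\|dx\|/(1-\|x\|^2)$ (identified with the hyperboloid $\|u\|^2-t^2=-1$, $t>0$, through $(u,t)\mapsto u/(1+t)$), and this action extends continuously to an action on the boundary $\mathbb S^n$ by conformal diffeomorphisms: $\gamma x=u/t$ where $(u,t)=\gamma(x,1)$. For $\gamma\in\mathrm{SO}^+(n+1,1)$ and $x\in\mathbb S^n$ let $|\gamma'(x)|$ be the unique positive number for which $\gamma'(x)/|\gamma'(x)|:T_x\mathbb S^n\to T_{\gamma x}\mathbb S^n$ is orthogonal for the round metric. Then the formula $$U(\gamma)f(x)=|(\gamma^{-1})'(x)|^{n/2}f(\gamma^{-1}x)$$ defines a group homomorphism $U$ from $\mathrm{SO}^+(n+1,1)$ to the unitary group of $L^2(\mathbb S^n,\mu)$, and for every $\gamma\in\mathrm{SO}^+(n+1,1)$ the operator $U(\gamma)$ maps $\operatorname{Dom}\Delta$ into $\operatorname{Dom}\Delta$ and the commutator $[\Delta,U(\gamma)]:\operatorname{Dom}\Delta\to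 L^2(\mathbb S^n,\mu)$ extends to a bounded operator on $L^2(\mathbb S^n,\mu)$. -/

import Mathlib

open MeasureTheory Module
open scoped Manifold Matrix ENNReal RealInnerProductSpace

noncomputable section

namespace LogLaplace

/-! ### Operators associated with forms -/

section Form

variable {H : Type*} [NormedAddCommGroup H] [InnerProductSpace ℝ H]

/-- The graph of the operator `A` associated with a bilinear form `Q` with domain `D ⊆ H`.
Write `R f` for the element `u ∈ D` with `⟪u, g⟫ + Q u g = ⟪f, g⟫` for all `g ∈ D`. The operator is
`A (R f) = f - R f` on `Dom A = R H`, so `(u, w)` lies in its graph iff `u = R (w + u)`. -/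
def formGraph (D : Submodule ℝ H) (Q : D →ₗ[ℝ] D →ₗ[ℝ] ℝ) : Submodule ℝ (H × H) where
  carrier := {p | ∃ hu : p.1 ∈ D, ∀ g : D,
    ⟪p.1, (g : H)⟫ + Q ⟨p.1, hu⟩ g = ⟪p.2 + p.1, (g : H)⟫}
  zero_mem' := ⟨D.zero_mem, fun g => by
    have h0 : (⟨(0 : H × H).1, D.zero_mem⟩ : D) = 0 := rfl
    rw [h0]; simp⟩
  add_mem' := by
    rintro p q ⟨hp, hp'⟩ ⟨hq, hq'⟩
    refine ⟨D.add_mem hp hq, fun g => ?_⟩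
    have h0 : (⟨(p + q).1, D.add_mem hp hq⟩ : D) = ⟨p.1, hp⟩ + ⟨q.1, hq⟩ := rfl
    have h1 := hp' g
    have h2 := hq' g
    rw [h0, map_add, LinearMap.add_apply]
    simp only [Prod.fst_add, Prod.snd_add, inner_add_left] at *
    linarith
  smul_mem' := by
    rintro c p ⟨hp, hp'⟩
    refine ⟨D.smul_mem c hp, fun g => ?_⟩
    have h0 : (⟨(c • p).1, D.smul_mem c hp⟩ : D) = c • ⟨p.1, hp⟩ := rfl
    have h1 := hp' g
    rw [h0, map_smul, LinearMap.smul_apply]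
    simp only [Prod.smul_fst, Prod.smul_snd, inner_add_left, real_inner_smul_left,
      smul_eq_mul] at *
    linear_combination c * h1

/-- The unbounded operator associated with a densely defined form. -/
def formOperator (D : Submodule ℝ H) (Q : D →ₗ[ℝ] D →ₗ[ℝ] ℝ) : H →ₗ.[ℝ] H :=
  (formGraph D Q).toLinearPMap

/-- For a densely defined form the relation `formGraph` is single valued, so that it is the graph of
`formOperator`. -/
theorem formOperator_graph (D : Submodule ℝ H) (Q : D →ₗ[ℝ] D →ₗ[ℝ] ℝ)
    (hD : Dense (D : Set H)) : (formOperator D Q).graph = formGraph D Q := by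
  refine Submodule.toLinearPMap_graph_eq _ ?_
  rintro ⟨u, w⟩ ⟨hu, h⟩ h0
  simp only at h0
  subst h0
  refine hD.eq_zero_of_inner_left (𝕜 := ℝ) fun g hg => ?_
  have h1 := h ⟨g, hg⟩
  have h2 : (⟨0, hu⟩ : D) = 0 := rfl
  simp only [h2, map_zero, LinearMap.zero_apply, inner_zero_left, add_zero] at h1
  exact h1.symm

end Form

/-! ### The logarithmic Dirichlet Laplacian of a metric-measure space of dimension `δ` -/

section Log

variable {X : Type*} [MetricSpace X] [SecondCountableTopology X] [MeasurableSpace X] [BorelSpace X]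

/-- The integrand `(f x - f y) (g x - g y) / d(x, y) ^ δ`. It vanishes on the diagonal. -/
def logIntegrand (δ : ℝ) (f g : X → ℝ) (p : X × X) : ℝ :=
  (f p.1 - f p.2) * (g p.1 - g p.2) / dist p.1 p.2 ^ δ

set_option linter.unusedSectionVars false

variable {μ : Measure X} [IsFiniteMeasure μ]

theorem logIntegrand_congr (δ : ℝ) {f f' g g' : X → ℝ} (hf : f =ᵐ[μ] f') (hg : g =ᵐ[μ] g') :
    logIntegrand δ f g =ᵐ[μ.prod μ] logIntegrand δ f' g' := by
  filter_upwards [Measure.quasiMeasurePreserving_fst.ae hf, Measure.quasiMeasurePreserving_snd.ae hf,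
    Measure.quasiMeasurePreserving_fst.ae hg, Measure.quasiMeasurePreserving_snd.ae hg]
    with p h1 h2 h3 h4
  simp only [logIntegrand, h1, h2, h3, h4]

theorem aestronglyMeasurable_logIntegrand (δ : ℝ) {f g : X → ℝ}
    (hf : AEStronglyMeasurable f μ) (hg : AEStronglyMeasurable g μ) :
    AEStronglyMeasurable (logIntegrand δ f g) (μ.prod μ) := by
  have hd : Measurable fun p : X × X => dist p.1 p.2 ^ δ := by fun_prop
  exact (((hf.comp_fst.sub hf.comp_snd).mul (hg.comp_fst.sub hg.comp_snd)).aemeasurable.div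
    hd.aemeasurable).aestronglyMeasurable

theorem logIntegrand_self_nonneg (δ : ℝ) (f : X → ℝ) (p : X × X) : 0 ≤ logIntegrand δ f f p :=
  div_nonneg (mul_self_nonneg _) (Real.rpow_nonneg dist_nonneg _)

theorem integrable_logIntegrand (δ : ℝ) {f g : X → ℝ}
    (hf : AEStronglyMeasurable f μ) (hg : AEStronglyMeasurable g μ)
    (hff : Integrable (logIntegrand δ f f) (μ.prod μ))
    (hgg : Integrable (logIntegrand δ g g) (μ.prod μ)) :
    Integrable (logIntegrand δ f g) (μ.prod μ) := by
  refine (hff.add hgg).mono (aestronglyMeasurable_logIntegrand δ hf hg)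
    (Filter.Eventually.of_forall fun p => ?_)
  have hd : 0 ≤ dist p.1 p.2 ^ δ := Real.rpow_nonneg dist_nonneg _
  rw [Pi.add_apply, Real.norm_of_nonneg
    (add_nonneg (logIntegrand_self_nonneg δ f p) (logIntegrand_self_nonneg δ g p))]
  simp only [logIntegrand, Real.norm_eq_abs, abs_div, abs_of_nonneg hd, ← add_div]
  refine div_le_div_of_nonneg_right ?_ hd
  rw [abs_le]
  constructor <;> nlinarith [sq_nonneg ((f p.1 - f p.2) + (g p.1 - g p.2)),
    sq_nonneg ((f p.1 - f p.2) - (g p.1 - g p.2)), sq_nonneg (f p.1 - f p.2),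
    sq_nonneg (g p.1 - g p.2)]

variable (μ) in
/-- The form domain: all `f ∈ L²(X, μ)` with `∬ |f x - f y|² / d(x, y) ^ δ < ∞`. -/
def logDomain (δ : ℝ) : Submodule ℝ (Lp ℝ 2 μ) where
  carrier := {f | Integrable (logIntegrand δ f f) (μ.prod μ)}
  zero_mem' := by
    have h : logIntegrand δ (0 : X → ℝ) 0 = 0 := by ext p; simp [logIntegrand]
    refine Integrable.congr (f := (0 : X × X → ℝ)) (integrable_zero _ _ _) ?_
    rw [← h]
    exact logIntegrand_congr δ (Lp.coeFn_zero ℝ 2 μ).symm (Lp.coeFn_zero ℝ 2 μ).symm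
  add_mem' := by
    intro f g hf hg
    have hfm := (Lp.memLp f).aestronglyMeasurable
    have hgm := (Lp.memLp g).aestronglyMeasurable
    have h := integrable_logIntegrand δ hfm hgm hf hg
    refine ((hf.add (h.const_mul 2)).add hg).congr ?_
    refine Filter.EventuallyEq.trans (Filter.Eventually.of_forall fun p => ?_)
      (logIntegrand_congr δ (Lp.coeFn_add f g).symm (Lp.coeFn_add f g).symm)
    simp only [logIntegrand, Pi.add_apply]
    ring
  smul_mem' := by
    intro c f hf
    refine (Integrable.const_mul hf (c * c)).congr ?_
    refine Filter.EventuallyEq.trans (Filter.Eventually.of_forall fun p => ?_)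
      (logIntegrand_congr δ (Lp.coeFn_smul c f).symm (Lp.coeFn_smul c f).symm)
    simp only [logIntegrand, Pi.smul_apply, smul_eq_mul]
    ring

variable (μ) in
/-- The form `E(f, g) = 1/2 ∬ (f x - f y) (g x - g y) / d(x, y) ^ δ dμ(y) dμ(x)` on its domain. -/
def logForm (δ : ℝ) : logDomain μ δ →ₗ[ℝ] logDomain μ δ →ₗ[ℝ] ℝ :=
  LinearMap.mk₂ ℝ
    (fun f g => (1 / 2) * ∫ p, logIntegrand δ (f : Lp ℝ 2 μ) (g : Lp ℝ 2 μ) p ∂(μ.prod μ))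
    (fun f f' g => by
      have hm := fun f : logDomain μ δ => (Lp.memLp (f : Lp ℝ 2 μ)).aestronglyMeasurable
      rw [← mul_add, ← integral_add (integrable_logIntegrand δ (hm f) (hm g) f.2 g.2)
        (integrable_logIntegrand δ (hm f') (hm g) f'.2 g.2)]
      refine congrArg (fun r : ℝ => (1 / 2) * r) ?_
      refine integral_congr_ae ?_
      refine (logIntegrand_congr δ (Lp.coeFn_add (f : Lp ℝ 2 μ) f') (Filter.EventuallyEq.refl _ _)).trans
        (Filter.Eventually.of_forall fun p => ?_)
      simp only [logIntegrand, Pi.add_apply]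
      ring)
    (fun c f g => by
      rw [smul_eq_mul, mul_left_comm, ← integral_const_mul c]
      refine congrArg (fun r : ℝ => (1 / 2) * r) ?_
      refine integral_congr_ae ?_
      refine (logIntegrand_congr δ (Lp.coeFn_smul c (f : Lp ℝ 2 μ)) (Filter.EventuallyEq.refl _ _)).trans
        (Filter.Eventually.of_forall fun p => ?_)
      simp only [logIntegrand, Pi.smul_apply, smul_eq_mul]
      ring)
    (fun f g g' => by
      have hm := fun f : logDomain μ δ => (Lp.memLp (f : Lp ℝ 2 μ)).aestronglyMeasurable
      rw [← mul_add, ← integral_add (integrable_logIntegrand δ (hm f) (hm g) f.2 g.2)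
        (integrable_logIntegrand δ (hm f) (hm g') f.2 g'.2)]
      refine congrArg (fun r : ℝ => (1 / 2) * r) ?_
      refine integral_congr_ae ?_
      refine (logIntegrand_congr δ (Filter.EventuallyEq.refl _ _) (Lp.coeFn_add (g : Lp ℝ 2 μ) g')).trans
        (Filter.Eventually.of_forall fun p => ?_)
      simp only [logIntegrand, Pi.add_apply]
      ring)
    (fun c f g => by
      rw [smul_eq_mul, mul_left_comm, ← integral_const_mul c]
      refine congrArg (fun r : ℝ => (1 / 2) * r) ?_
      refine integral_congr_ae ?_
      refine (logIntegrand_congr δ (Filter.EventuallyEq.refl _ _) (Lp.coeFn_smul c (g : Lp ℝ 2 μ))).trans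
        (Filter.Eventually.of_forall fun p => ?_)
      simp only [logIntegrand, Pi.smul_apply, smul_eq_mul]
      ring)

variable (μ) in
/-- The logarithmic Dirichlet Laplacian of `(X, d, μ)`, where `δ` is the dimension of `X`. -/
def logLaplacian (δ : ℝ) : Lp ℝ 2 μ →ₗ.[ℝ] Lp ℝ 2 μ :=
  formOperator (logDomain μ δ) (logForm μ δ)

end Log

/-! ### The group `SO⁺(n+1,1)` and its action on the sphere `Sⁿ` -/

/-- `ℝⁿ⁺¹` with the Euclidean norm. -/
abbrev E (n : ℕ) : Type := EuclideanSpace ℝ (Fin (n + 1))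

/-- The unit sphere `Sⁿ ⊆ ℝⁿ⁺¹`; as a metric space it carries the chordal distance `‖x - y‖`. -/
abbrev S (n : ℕ) : Type := Metric.sphere (0 : E n) 1

/-- The volume measure of the round metric on `Sⁿ`. -/
abbrev sphereMeasure (n : ℕ) : Measure (S n) := (volume : Measure (E n)).toSphere

/-- Real square matrices of size `n + 2`, acting on `ℝⁿ⁺¹ × ℝ`. -/
abbrev Mat (n : ℕ) : Type := Matrix (Fin (n + 1) ⊕ Unit) (Fin (n + 1) ⊕ Unit) ℝ

/-- The matrix of the Lorentz form `x₁² + ⋯ + xₙ₊₁² - t²`. -/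
abbrev lorentzForm (n : ℕ) : Mat n := LieAlgebra.Orthogonal.indefiniteDiagonal (Fin (n + 1)) Unit ℝ

/-- The vector `(p, s) ∈ ℝⁿ⁺¹ × ℝ` as a column of length `n + 2`. -/
def col {n : ℕ} (p : E n) (s : ℝ) : Fin (n + 1) ⊕ Unit → ℝ := Sum.elim p fun _ => s

/-- The space component `u` of `A (p, s) = (u, t)`. -/
def spacePart {n : ℕ} (A : Mat n) (p : E n) (s : ℝ) : E n :=
  WithLp.toLp 2 fun i => (A *ᵥ col p s) (Sum.inl i)

/-- The time component `t` of `A (p, s) = (u, t)`. -/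
def timePart {n : ℕ} (A : Mat n) (p : E n) (s : ℝ) : ℝ := (A *ᵥ col p s) (Sum.inr ())

theorem col_parts {n : ℕ} (A : Mat n) (p : E n) (s : ℝ) :
    col (spacePart A p s) (timePart A p s) = A *ᵥ col p s := by
  ext (i | i) <;> rfl

theorem col_lorentzForm_col {n : ℕ} (p q : E n) (s r : ℝ) :
    col p s ⬝ᵥ lorentzForm n *ᵥ col q r = ⟪p, q⟫ - s * r := by
  simp [lorentzForm, LieAlgebra.Orthogonal.indefiniteDiagonal, Matrix.mulVec_diagonal, dotProduct,
    col, PiLp.inner_apply, mul_comm, sub_eq_add_neg]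

theorem inner_parts {n : ℕ} {A : Mat n} (hA : Aᵀ * lorentzForm n * A = lorentzForm n)
    (p q : E n) (s r : ℝ) :
    ⟪spacePart A p s, spacePart A q r⟫ - timePart A p s * timePart A q r = ⟪p, q⟫ - s * r := by
  rw [← col_lorentzForm_col, ← col_lorentzForm_col, col_parts, col_parts]
  conv_rhs => rw [← hA]
  rw [← Matrix.mulVec_mulVec, ← Matrix.mulVec_mulVec, Matrix.dotProduct_mulVec _ Aᵀ,
    Matrix.vecMul_transpose]

theorem lorentzForm_mul_self (n : ℕ) : lorentzForm n * lorentzForm n = 1 := by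
  rw [lorentzForm, LieAlgebra.Orthogonal.indefiniteDiagonal, Matrix.diagonal_mul_diagonal,
    ← Matrix.diagonal_one]
  congr 1
  ext (i | i) <;> simp

theorem left_inv_of_lorentz {n : ℕ} {A : Mat n} (hA : Aᵀ * lorentzForm n * A = lorentzForm n) :
    lorentzForm n * Aᵀ * lorentzForm n * A = 1 := by
  rw [mul_assoc, mul_assoc, ← mul_assoc Aᵀ, hA, lorentzForm_mul_self]

theorem lorentz_transpose {n : ℕ} {A : Mat n} (hA : Aᵀ * lorentzForm n * A = lorentzForm n) :
    A * lorentzForm n * Aᵀ = lorentzForm n := by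
  have h := mul_eq_one_comm.mp (left_inv_of_lorentz hA)
  calc A * lorentzForm n * Aᵀ
      = A * (lorentzForm n * Aᵀ * lorentzForm n) * lorentzForm n := by
        simp only [mul_assoc, lorentzForm_mul_self, mul_one]
    _ = lorentzForm n := by rw [h, one_mul]

/-- A Lorentz matrix that preserves the direction of time maps nonzero vectors `(p, s)` of the closed
future cone to vectors with positive time component. -/
theorem timePart_pos {n : ℕ} {A : Mat n} (hA : Aᵀ * lorentzForm n * A = lorentzForm n)
    (h0 : 0 < A (Sum.inr ()) (Sum.inr ())) {p : E n} {s : ℝ} (hs : 0 < s) (hp : ‖p‖ ≤ s) :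
    0 < timePart A p s := by
  set a : E n := WithLp.toLp 2 fun i => A (Sum.inr ()) (Sum.inl i) with ha
  set c := A (Sum.inr ()) (Sum.inr ()) with hc
  have h1 : timePart A p s = ⟪a, p⟫ + c * s := by
    simp [timePart, Matrix.mulVec, dotProduct, col, PiLp.inner_apply, ha, hc, mul_comm]
  have h2 : ‖a‖ ^ 2 - c * c = -1 := by
    have h := congrFun (congrFun (lorentz_transpose hA) (Sum.inr ())) (Sum.inr ())
    rw [← real_inner_self_eq_norm_sq]
    rw [Matrix.mul_apply] at h
    simp only [lorentzForm, LieAlgebra.Orthogonal.indefiniteDiagonal,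
      Matrix.mul_diagonal, Matrix.transpose_apply, Fintype.sum_sum_type] at h
    have e : ⟪a, a⟫ = ∑ i, A (Sum.inr ()) (Sum.inl i) * A (Sum.inr ()) (Sum.inl i) := by
      simp only [PiLp.inner_apply, ha]
      rfl
    rw [e]
    simpa [hc, sub_eq_add_neg] using h
  have h3 : ‖a‖ < c := by nlinarith [norm_nonneg a]
  have h4 := (abs_le.mp (abs_real_inner_le_norm a p)).1
  have h5 : ‖a‖ * ‖p‖ ≤ ‖a‖ * s := by gcongr
  have h6 : ‖a‖ * s < c * s := by gcongr
  rw [h1]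
  linarith

/-- `SO⁺(n+1,1)`: the real matrices of determinant one that preserve the Lorentz form
`x₁² + ⋯ + xₙ₊₁² - t²` and the direction of time. -/
def SOPlus (n : ℕ) : Subgroup (Matrix.SpecialLinearGroup (Fin (n + 1) ⊕ Unit) ℝ) where
  carrier := {A | A.1ᵀ * lorentzForm n * A.1 = lorentzForm n ∧ 0 < A.1 (Sum.inr ()) (Sum.inr ())}
  one_mem' := by simp
  mul_mem' := by
    rintro A B ⟨hA, hA'⟩ ⟨hB, hB'⟩
    refine ⟨?_, ?_⟩
    · calc (A.1 * B.1)ᵀ * lorentzForm n * (A.1 * B.1) = B.1ᵀ * (A.1ᵀ * lorentzForm n * A.1) * B.1 := by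
            simp only [mul_assoc, Matrix.transpose_mul]
        _ = _ := by rw [hA, hB]
    · have e : ∀ C : Mat n, timePart C 0 1 = C (Sum.inr ()) (Sum.inr ()) := fun C => by
        simp [timePart, Matrix.mulVec, dotProduct, col]
      have h1 := inner_parts hB 0 0 1 1
      have h2 : 0 < timePart B.1 0 1 := by rw [e]; exact hB'
      have h3 : ‖spacePart B.1 0 1‖ ≤ timePart B.1 0 1 := by
        rw [real_inner_self_eq_norm_sq, inner_zero_left] at h1
        exact abs_le_of_sq_le_sq' (by nlinarith) h2.le |>.2
      have h4 := timePart_pos hA hA' h2 h3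
      rw [timePart, col_parts, Matrix.mulVec_mulVec] at h4
      exact h4.trans_eq (e (A.1 * B.1))
  inv_mem' := by
    rintro A ⟨hA, hA'⟩
    have h : (A⁻¹).1 =
        lorentzForm n * A.1ᵀ * lorentzForm n := by
      have h1 : (A⁻¹).1 * A.1 = 1 := by
        exact congrArg Subtype.val (inv_mul_cancel A)
      exact left_inv_eq_right_inv h1 (mul_eq_one_comm.mp (left_inv_of_lorentz hA))
    have hJ : (lorentzForm n)ᵀ = lorentzForm n := Matrix.diagonal_transpose _
    refine ⟨?_, ?_⟩
    · rw [h]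
      simp only [Matrix.transpose_mul, Matrix.transpose_transpose, hJ]
      calc _ = lorentzForm n * (A.1 * (lorentzForm n * lorentzForm n * lorentzForm n) *
            A.1ᵀ) * lorentzForm n := by simp only [mul_assoc]
        _ = _ := by
          rw [lorentzForm_mul_self, one_mul, lorentz_transpose hA, lorentzForm_mul_self, one_mul]
    · rw [h]
      simpa [lorentzForm, LieAlgebra.Orthogonal.indefiniteDiagonal, Matrix.mul_diagonal,
        Matrix.diagonal_mul] using hA'

/-- The matrix of an element of `SO⁺(n+1,1)`. -/
abbrev mat {n : ℕ} (γ : SOPlus n) : Mat n := γ.1.1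

/-- The action of `SO⁺(n+1,1)` on the closed unit ball of `ℝⁿ⁺¹`. On the open ball, identified with the
hyperboloid `‖u‖² - t² = -1`, `t > 0`, through `p ↦ (2 p, 1 + ‖p‖²) / (1 - ‖p‖²)`, whose inverse is
`(u, t) ↦ u / (1 + t)`, this is the linear action; these are isometries of the Poincaré metric
`2 ‖dx‖ / (1 - ‖x‖²)`. The formula is written without the denominator `1 - ‖p‖²`, so that it is also the
continuous extension to the boundary. -/
def ballAct {n : ℕ} (γ : SOPlus n) (p : E n) : E n :=
  (1 - ‖p‖ ^ 2 + timePart (mat γ) ((2 : ℝ) • p) (1 + ‖p‖ ^ 2))⁻¹ •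
    spacePart (mat γ) ((2 : ℝ) • p) (1 + ‖p‖ ^ 2)

theorem spacePart_smul {n : ℕ} (A : Mat n) (c : ℝ) (p : E n) (s : ℝ) :
    spacePart A (c • p) (c * s) = c • spacePart A p s := by
  have h : col (c • p) (c * s) = c • col p s := by ext (i | i) <;> simp [col]
  ext i
  simp [spacePart, h, Matrix.mulVec_smul]

theorem timePart_smul {n : ℕ} (A : Mat n) (c : ℝ) (p : E n) (s : ℝ) :
    timePart A (c • p) (c * s) = c * timePart A p s := by
  have h : col (c • p) (c * s) = c • col p s := by ext (i | i) <;> simp [col]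
  simp [timePart, h, Matrix.mulVec_smul]

/-- On the boundary, `γ` sends `x` to `u / t`, where `(u, t) = γ (x, 1)`. -/
theorem ballAct_sphere {n : ℕ} (γ : SOPlus n) {x : E n} (hx : ‖x‖ = 1) :
    ballAct γ x = (timePart (mat γ) x 1)⁻¹ • spacePart (mat γ) x 1 := by
  have h : (1 : ℝ) + ‖x‖ ^ 2 = 2 * 1 := by rw [hx]; norm_num
  rw [ballAct, h, timePart_smul, spacePart_smul, hx, smul_smul]
  congr 1
  rw [one_pow, sub_self, zero_add, mul_inv, mul_comm, ← mul_assoc, mul_inv_cancel₀ two_ne_zero,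
    one_mul]

theorem norm_ballAct_sphere {n : ℕ} (γ : SOPlus n) {x : E n} (hx : ‖x‖ = 1) :
    ‖ballAct γ x‖ = 1 := by
  have h1 := inner_parts γ.2.1 x x 1 1
  have h2 := timePart_pos γ.2.1 γ.2.2 one_pos hx.le
  rw [real_inner_self_eq_norm_sq, real_inner_self_eq_norm_sq, hx] at h1
  have h3 : ‖spacePart (mat γ) x 1‖ = timePart (mat γ) x 1 := by
    rw [← abs_of_pos h2, ← abs_of_nonneg (norm_nonneg (spacePart (mat γ) x 1)), ← sq_eq_sq_iff_abs_eq_abs]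
    change ‖spacePart (mat γ) x 1‖ ^ 2 = timePart (mat γ) x 1 ^ 2
    linarith
  rw [ballAct_sphere γ hx, norm_smul, h3, norm_inv, Real.norm_of_nonneg h2.le,
    inv_mul_cancel₀ h2.ne']

/-- The action of `SO⁺(n+1,1)` on the boundary sphere `Sⁿ`. -/
def sphereAct {n : ℕ} (γ : SOPlus n) (x : S n) : S n :=
  ⟨ballAct γ x, by
    rw [mem_sphere_zero_iff_norm]
    exact norm_ballAct_sphere γ (mem_sphere_zero_iff_norm.mp x.2)⟩

/-- `c = |g'(x)|`, that is, `c` is a positive number such that `c⁻¹ g'(x)` is an isometry for the round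
metric. Tangent vectors of `Sⁿ` are measured through the derivative of the inclusion `Sⁿ ⊆ ℝⁿ⁺¹`. -/
def IsScale {n : ℕ} (g : S n → S n) (x : S n) (c : ℝ) : Prop :=
  MDifferentiableAt (𝓡 n) (𝓡 n) g x ∧ 0 < c ∧ ∀ v : TangentSpace (𝓡 n) x,
    ‖mvfderiv (𝓡 n) (fun y : S n => (y : E n)) (g x) (mfderiv (𝓡 n) (𝓡 n) g x v)‖ =
      c * ‖mvfderiv (𝓡 n) (fun y : S n => (y : E n)) x v‖

/-- For `n ≥ 1` there is at most one such number. -/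
theorem IsScale.unique {n : ℕ} (hn : 1 ≤ n) {g : S n → S n} {x : S n} {c c' : ℝ}
    (h : IsScale g x c) (h' : IsScale g x c') : c = c' := by
  obtain ⟨v, hv⟩ : ∃ v : EuclideanSpace ℝ (Fin n), v ≠ 0 :=
    ⟨EuclideanSpace.single ⟨0, hn⟩ 1, by simp⟩
  have : Fact (finrank ℝ (E n) = n + 1) := ⟨finrank_euclideanSpace_fin⟩
  have hv' : mvfderiv (𝓡 n) (fun y : S n => (y : E n)) x v ≠ 0 := fun h0 =>
    hv (injective_mvfderiv_subtypeVal_sphere x (h0.trans (map_zero _).symm))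
  exact mul_right_cancel₀ (norm_ne_zero_iff.mpr hv') ((h.2.2 v).symm.trans (h'.2.2 v))

theorem coe_sphereAct {n : ℕ} (γ : SOPlus n) (x : S n) :
    (sphereAct γ x : E n) = (timePart (mat γ) x 1)⁻¹ • spacePart (mat γ) (x : E n) 1 :=
  ballAct_sphere γ (mem_sphere_zero_iff_norm.mp x.2)

/-- `timePart` as a linear map in the space variable. -/
def timeLin {n : ℕ} (A : Mat n) : E n →L[ℝ] ℝ :=
  LinearMap.toContinuousLinearMap
    { toFun := fun p => timePart A p 0
      map_add' := fun p q => by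
        have h : col (p + q) 0 = col p 0 + col q 0 := by ext (i | i) <;> simp [col]
        simp [timePart, h, Matrix.mulVec_add]
      map_smul' := fun c p => by
        have h := timePart_smul A c p 0
        rwa [mul_zero] at h }

/-- `spacePart` as a linear map in the space variable. -/
def spaceLin {n : ℕ} (A : Mat n) : E n →L[ℝ] E n :=
  LinearMap.toContinuousLinearMap
    { toFun := fun p => spacePart A p 0
      map_add' := fun p q => by
        have h : col (p + q) 0 = col p 0 + col q 0 := by ext (i | i) <;> simp [col]
        ext i
        simp [spacePart, h, Matrix.mulVec_add]
      map_smul' := fun c p => by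
        have h := spacePart_smul A c p 0
        rwa [mul_zero] at h }

theorem hasFDerivAt_timePart {n : ℕ} (A : Mat n) (p : E n) (s : ℝ) :
    HasFDerivAt (fun q => timePart A q s) (timeLin A) p := by
  have h : (fun q => timePart A q s) = fun q => timeLin A q + timePart A 0 s := by
    ext q
    have h : col q s = col q 0 + col 0 s := by ext (i | i) <;> simp [col]
    change timePart A q s = timePart A q 0 + timePart A 0 s
    simp [timePart, h, Matrix.mulVec_add]
  rw [h]
  exact (timeLin A).hasFDerivAt.add_const _

theorem hasFDerivAt_spacePart {n : ℕ} (A : Mat n) (p : E n) (s : ℝ) :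
    HasFDerivAt (fun q => spacePart A q s) (spaceLin A) p := by
  have h : (fun q => spacePart A q s) = fun q => spaceLin A q + spacePart A 0 s := by
    ext q i
    have h : col q s = col q 0 + col 0 s := by ext (i | i) <;> simp [col]
    change spacePart A q s i = (spacePart A q 0 + spacePart A 0 s) i
    simp [spacePart, h, Matrix.mulVec_add]
  rw [h]
  exact (spaceLin A).hasFDerivAt.add_const _

theorem mdifferentiable_sphereAct {n : ℕ} (γ : SOPlus n) :
    MDifferentiable (𝓡 n) (𝓡 n) (sphereAct γ) := by
  have : Fact (finrank ℝ (E n) = n + 1) := ⟨finrank_euclideanSpace_fin⟩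
  have h : ContMDiff (𝓡 n) 𝓘(ℝ, E n) 1 fun x : S n => (sphereAct γ x : E n) := by
    intro x
    have hx := (timePart_pos γ.2.1 γ.2.2 one_pos (mem_sphere_zero_iff_norm.mp x.2).le).ne'
    have h1 : ContDiff ℝ 1 fun q : E n => timePart (mat γ) q 1 :=
      contDiff_one_iff_hasFDerivAt.mpr
        ⟨_, continuous_const, fun q => hasFDerivAt_timePart (mat γ) q 1⟩
    have h2 : ContDiff ℝ 1 fun q : E n => spacePart (mat γ) q 1 :=
      contDiff_one_iff_hasFDerivAt.mpr
        ⟨_, continuous_const, fun q => hasFDerivAt_spacePart (mat γ) q 1⟩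
    have h3 := ((h1.contDiffAt (x := (x : E n))).inv hx).smul (h2.contDiffAt (x := (x : E n)))
    have h4 : ContMDiffAt (𝓡 n) 𝓘(ℝ, E n) 1 (fun y : S n => (y : E n)) x := contMDiff_coe_sphere x
    refine (h3.contMDiffAt.comp x h4).congr_of_eventuallyEq (Filter.Eventually.of_forall fun y => ?_)
    exact coe_sphereAct γ y
  exact (h.codRestrict_sphere fun x => (sphereAct γ x).2).mdifferentiable one_ne_zero

/-- The derivative of the action of `γ` at `x` is `1 / t` times an isometry, where
`(u, t) = γ (x, 1)`. -/
theorem isScale_sphereAct {n : ℕ} (γ : SOPlus n) (x : S n) :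
    IsScale (sphereAct γ) x (timePart (mat γ) x 1)⁻¹ := by
  have : Fact (finrank ℝ (E n) = n + 1) := ⟨finrank_euclideanSpace_fin⟩
  have hx := timePart_pos γ.2.1 γ.2.2 one_pos (mem_sphere_zero_iff_norm.mp x.2).le
  refine ⟨mdifferentiable_sphereAct γ x, inv_pos.mpr hx, fun v => ?_⟩
  have hc : ∀ y : S n, MDifferentiableAt (𝓡 n) 𝓘(ℝ, E n) (fun z : S n => (z : E n)) y := fun y =>
    (contMDiff_coe_sphere (m := 1) y).mdifferentiableAt one_ne_zero
  set F : E n → E n := fun q => (timePart (mat γ) q 1)⁻¹ • spacePart (mat γ) q 1 with hF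
  have hFd : HasFDerivAt F _ (x : E n) := ((hasDerivAt_inv hx.ne').comp_hasFDerivAt (x : E n)
    (hasFDerivAt_timePart (mat γ) x 1)).smul (hasFDerivAt_spacePart (mat γ) x 1)
  set w : E n := mvfderiv (𝓡 n) (fun y : S n => (y : E n)) x v with hw
  have hwx : ⟪(x : E n), w⟫ = 0 := by
    have h : w ∈ (mvfderiv (𝓡 n) (fun y : S n => (y : E n)) x).range := ⟨v, rfl⟩
    rw [range_mvfderiv_subtypeVal x] at h
    exact Submodule.mem_orthogonal_singleton_iff_inner_right.mp h
  have key : mvfderiv (𝓡 n) (fun y : S n => (y : E n)) (sphereAct γ x)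
      (mfderiv (𝓡 n) (𝓡 n) (sphereAct γ) x v) = fderiv ℝ F x w := by
    have h1 := mfderiv_comp_apply x (hc (sphereAct γ x)) (mdifferentiable_sphereAct γ x) v
    have h2 := mfderiv_comp_apply x hFd.differentiableAt.mdifferentiableAt (hc x) v
    have h3 : (fun y : S n => (y : E n)) ∘ sphereAct γ = F ∘ fun y : S n => (y : E n) :=
      funext fun y => coe_sphereAct γ y
    rw [mfderiv_eq_fderiv] at h2
    rw [h3] at h1
    exact h1.symm.trans h2
  rw [key, hFd.fderiv]
  have e1 := inner_parts γ.2.1 w w 0 0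
  have e2 := inner_parts γ.2.1 (x : E n) w 1 0
  have e3 := inner_parts γ.2.1 (x : E n) x 1 1
  simp only [mul_zero, sub_zero, mul_one, hwx, real_inner_self_eq_norm_sq,
    mem_sphere_zero_iff_norm.mp x.2, one_pow, sub_self] at e1 e2 e3
  set t := timePart (mat γ) x 1
  set u := spacePart (mat γ) x 1
  set t' := timePart (mat γ) w 0
  set u' := spacePart (mat γ) w 0
  have e4 : ‖t • u' - t' • u‖ ^ 2 = (t * ‖w‖) ^ 2 := by
    rw [norm_sub_sq_real, norm_smul, norm_smul, real_inner_smul_left, real_inner_smul_right,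
      real_inner_comm, mul_pow, mul_pow, Real.norm_eq_abs, Real.norm_eq_abs, sq_abs, sq_abs]
    linear_combination t ^ 2 * e1 + t' ^ 2 * e3 - 2 * t * t' * e2
  have e5 : ‖t • u' - t' • u‖ = t * ‖w‖ :=
    (sq_eq_sq₀ (norm_nonneg _) (mul_nonneg hx.le (norm_nonneg _))).mp e4
  have e6 : t⁻¹ • u' + (-(t ^ 2)⁻¹ * t') • u = (t ^ 2)⁻¹ • (t • u' - t' • u) := by
    rw [smul_sub, smul_smul, smul_smul, neg_mul, neg_smul, sub_eq_add_neg]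
    congr 2
    field_simp
  calc _ = ‖t⁻¹ • u' + (-(t ^ 2)⁻¹ * t') • u‖ := rfl
    _ = t⁻¹ * ‖w‖ := by
      rw [e6, norm_smul, e5, Real.norm_of_nonneg (by positivity)]
      field_simp

theorem exists_isScale {n : ℕ} (γ : SOPlus n) (x : S n) : ∃ c, IsScale (sphereAct γ) x c :=
  ⟨_, isScale_sphereAct γ x⟩

/-- `|γ'(x)|`, the unique positive number such that `γ'(x) / |γ'(x)|` is orthogonal. -/
def scale {n : ℕ} (γ : SOPlus n) (x : S n) : ℝ := (exists_isScale γ x).choose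

end LogLaplace

end

open LogLaplace

open scoped NNReal

/-! Put `q = |γ'| ^ (n / 2)` and `V = U(γ)`, so that `(V f)(γ x) = f(x) / q(x)`. Two conformal
identities drive everything: `d(γ x, γ y) ^ n = q(x) q(y) d(x, y) ^ n`, and `γ` pushes `q² μ`
forward to `μ`. Substituting `γ` in both variables of `E(V f, V g)` turns the numerator into `q(x)
q(y) (f(x)/q(x) - f(y)/q(y)) (g(x)/q(x) - g(y)/q(y))`. Its mixed terms are those of `(f(x) - f(y))
(g(x) - g(y))`, so only the diagonal terms change: what remains is `(q(y)/q(x) - 1) f(x) g(x)` and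
its mirror image. By symmetry `E(V f, V g) = E(f, g) + ⟪M f, g⟫`, where `M` is multiplication by `∫
(q(y)/q(x) - 1) / d(x, y) ^ n dμ(y)` (`logForm_conformal`).

The function `M` is bounded: `q(y)/q(x) - 1` is `O(d(x, y))`, and `d ^ (1 - n)` is integrable on an
`n`-dimensional sphere uniformly in the base point (`exists_abs_confWeight_div_sub_one_le`,
`exists_lintegral_dist_le`). A unitary that changes the form only by a bounded form preserves the
operator domain, and here the commutator satisfies `[Δ, V] = V M` (`formOperator_commutator`).

Both conformal identities come from Lorentz geometry. With `γ (x, 1) = b(x) (γ x, 1)` one has `|γ'|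
= 1 / b`. The distance identity is invariance of the Lorentz product of `(x, 1)` and `(y, 1)`. The
measure identity follows from the action on the light cone, whose Jacobian in the space coordinate
is `b` (`abs_det_coneDeriv`, `lintegral_boost`). The operator is single valued because Lipschitz
functions lie in the form domain and are dense (`dense_logDomain`). -/

namespace LogLaplace

/-! ### Commutators from bounded perturbations of a form. -/

section Form

variable {H : Type*} [NormedAddCommGroup H] [InnerProductSpace ℝ H]

/-- If a unitary `V` preserves the form domain and changes the form only by a bounded form, then it
preserves the domain of the associated operator and commutes with it up to a bounded operator. -/
theorem formOperator_commutator {D : Submodule ℝ H} {Q : D →ₗ[ℝ] D →ₗ[ℝ] ℝ}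
    (hD : Dense (D : Set H)) (V : H ≃ₗᵢ[ℝ] H) (m : H →L[ℝ] H) (hV : ∀ f, V f ∈ D ↔ f ∈ D)
    (hQ : ∀ f g : D, Q ⟨V f, (hV f).2 f.2⟩ ⟨V g, (hV g).2 g.2⟩ = Q f g + ⟪m f, (g : H)⟫) :
    (∀ f ∈ (formOperator D Q).domain, V f ∈ (formOperator D Q).domain) ∧
    ∀ (f : (formOperator D Q).domain) (hf : V (f : H) ∈ (formOperator D Q).domain),
      formOperator D Q ⟨V (f : H), hf⟩ - V (formOperator D Q f) = V (m f) := by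
  -- Test the equation of `f` against `V⁻¹ g`: unitarity moves `V` across the inner product, and the
  -- change of the form adds `m f` to the right-hand side.
  have key : ∀ f w : H, (f, w) ∈ (formOperator D Q).graph →
      (V f, V (w + m f)) ∈ (formOperator D Q).graph := by
    intro f w h
    rw [formOperator_graph D Q hD] at h ⊢
    obtain ⟨hf, h⟩ := h
    refine ⟨(hV f).2 hf, fun g => ?_⟩
    have hg : V.symm g ∈ D := (hV _).1 (by rw [V.apply_symm_apply]; exact g.2)
    have h1 := hQ ⟨f, hf⟩ ⟨V.symm g, hg⟩
    have h2 := h ⟨V.symm g, hg⟩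
    have h3 : (⟨V (V.symm g), (hV _).2 hg⟩ : D) = g := Subtype.ext (V.apply_symm_apply g)
    simp only [h3] at h1
    have h4 : ∀ u : H, ⟪V u, (g : H)⟫ = ⟪u, V.symm g⟫ := fun u => by
      conv_lhs => rw [← V.apply_symm_apply (g : H)]
      exact V.inner_map_map _ _
    simp only at h2 ⊢
    rw [h1, ← map_add, h4, h4, add_right_comm w, inner_add_left, ← h2]
    ring
  refine ⟨fun f hf => ?_, fun f hf => ?_⟩
  · rw [LinearPMap.mem_domain_iff] at hf ⊢
    obtain ⟨w, hw⟩ := hf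
    exact ⟨_, key f w hw⟩
  · have h1 := key f _ (LinearPMap.mem_graph _ f)
    have h2 := LinearPMap.mem_graph _ (⟨V (f : H), hf⟩ : (formOperator D Q).domain)
    rw [LinearPMap.mem_graph_snd_inj _ h2 h1 rfl, map_add, add_sub_cancel_left]

end Form

/-! ### Multiplication operators, change of variables and kernels on a product. -/

section Kernel

variable {X : Type*} [MeasurableSpace X] {μ : Measure X}

theorem norm_integral_kernel_le {κ : X × X → ℝ} {K : ℝ≥0}
    (hK : ∀ x, ∫⁻ y, ‖κ (x, y)‖ₑ ∂μ ≤ K) (x : X) : ‖∫ y, κ (x, y) ∂μ‖ ≤ K := by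
  have h := (enorm_integral_le_lintegral_enorm fun y => κ (x, y)).trans (hK x)
  exact_mod_cast h

/-- Multiplication by a bounded measurable function, as an operator on `L²`. -/
theorem exists_mul_operator {M : X → ℝ} (hM : Measurable M) {K : ℝ} (hK : ∀ x, ‖M x‖ ≤ K) :
    ∃ m : Lp ℝ 2 μ →L[ℝ] Lp ℝ 2 μ, ∀ f : Lp ℝ 2 μ, m f =ᵐ[μ] fun x => M x * f x := by
  have hM' : MemLp M ∞ μ :=
    memLp_top_of_bound hM.aestronglyMeasurable K (Filter.Eventually.of_forall hK)
  refine ⟨(ContinuousLinearMap.mul ℝ ℝ).holderL μ ∞ 2 2 hM'.toLp, fun f => ?_⟩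
  rw [ContinuousLinearMap.holderL_apply_apply]
  refine (ContinuousLinearMap.coeFn_holder _ _ f).trans ?_
  filter_upwards [hM'.coeFn_toLp] with x hx
  simp [hx]

variable [SFinite μ]

/-- Change of variables in a double integral under a map that scales the measure by `q ^ 2`. -/
theorem changeOfVariables_prod {φ : X ≃ᵐ X} {q : X → ℝ} (hqm : Measurable q)
    (hφ : MeasurePreserving φ (μ.withDensity fun x => ENNReal.ofReal (q x ^ 2)) μ)
    (F : X × X → ℝ) :
    (Integrable (fun p => q p.1 ^ 2 * q p.2 ^ 2 * F (Prod.map φ φ p)) (μ.prod μ) ↔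
      Integrable F (μ.prod μ)) ∧
    ∫ p, q p.1 ^ 2 * q p.2 ^ 2 * F (Prod.map φ φ p) ∂(μ.prod μ) = ∫ p, F p ∂(μ.prod μ) := by
  set ρ : X × X → ℝ≥0 := fun p => (q p.1 ^ 2).toNNReal * (q p.2 ^ 2).toNNReal with hρ
  have hρm : Measurable ρ := by fun_prop
  have h1 := hφ.prod hφ
  rw [prod_withDensity (by fun_prop) (by fun_prop)] at h1
  have h2 : (fun p : X × X => ENNReal.ofReal (q p.1 ^ 2) * ENNReal.ofReal (q p.2 ^ 2)) =
      fun p => (ρ p : ℝ≥0∞) := by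
    ext p
    simp [hρ, ENNReal.ofReal]
  rw [h2] at h1
  have he : MeasurableEmbedding (Prod.map φ φ) := (φ.prodCongr φ).measurableEmbedding
  have h3 : (fun p => q p.1 ^ 2 * q p.2 ^ 2 * F (Prod.map φ φ p)) =
      fun p => ρ p • (F ∘ Prod.map φ φ) p := by
    ext p
    simp [hρ, NNReal.smul_def, sq_nonneg]
  rw [h3, ← integrable_withDensity_iff_integrable_smul hρm, h1.integrable_comp_emb he,
    ← integral_withDensity_eq_integral_smul hρm]
  exact ⟨Iff.rfl, h1.integral_comp he F⟩

/-- Integrability against a kernel with uniformly bounded sections. -/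
theorem integrable_kernel_mul {κ : X × X → ℝ} (hκ : Measurable κ) {K : ℝ≥0}
    (hK : ∀ x, ∫⁻ y, ‖κ (x, y)‖ₑ ∂μ ≤ K) {u : X → ℝ} (hu : Integrable u μ) :
    Integrable (fun p => κ p * u p.1) (μ.prod μ) := by
  have hm : AEStronglyMeasurable (fun p => κ p * u p.1) (μ.prod μ) :=
    hκ.aestronglyMeasurable.mul hu.1.comp_fst
  refine ⟨hm, ?_⟩
  rw [HasFiniteIntegral, lintegral_prod _ hm.enorm]
  calc ∫⁻ x, ∫⁻ y, ‖κ (x, y) * u x‖ₑ ∂μ ∂μ ≤ ∫⁻ x, K * ‖u x‖ₑ ∂μ := by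
        refine lintegral_mono fun x => ?_
        simp only [enorm_mul]
        rw [lintegral_mul_const _ (by fun_prop)]
        gcongr
        exact hK x
    _ = K * ∫⁻ x, ‖u x‖ₑ ∂μ := lintegral_const_mul' _ _ ENNReal.coe_ne_top
    _ < ⊤ := ENNReal.mul_lt_top ENNReal.coe_lt_top hu.2

theorem integral_kernel_mul {κ : X × X → ℝ} (hκ : Measurable κ) {K : ℝ≥0}
    (hK : ∀ x, ∫⁻ y, ‖κ (x, y)‖ₑ ∂μ ≤ K) {u : X → ℝ} (hu : Integrable u μ) :
    ∫ p, κ p * u p.1 ∂(μ.prod μ) = ∫ x, (∫ y, κ (x, y) ∂μ) * u x ∂μ := by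
  rw [integral_prod _ (integrable_kernel_mul hκ hK hu)]
  simp only [integral_mul_const]

end Kernel

/-! ### The form under an abstract conformal map. -/

section Conformal

variable {X : Type*} [MetricSpace X]

/-- The kernel `(q y / q x - 1) / d(x, y) ^ δ`, which measures how far the form is from being
invariant under a conformal map with scaling factor `q`. -/
noncomputable def scaleKernel (δ : ℝ) (q : X → ℝ) (p : X × X) : ℝ :=
  (q p.2 / q p.1 - 1) / dist p.1 p.2 ^ δ

/-- The factor `q(x)² q(y)²` from the measure and `1 / (q(x) q(y))` from the distance leave `q(x)
q(y)`, which cancels exactly against the weights in the mixed terms `f(x) g(y)` and `f(y) g(x)`.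
This is why the weight must be the square root of the density. -/
theorem logIntegrand_conformal {δ : ℝ} {φ : X → X} {q : X → ℝ} (hq : ∀ x, 0 < q x)
    (hd : ∀ x y, dist (φ x) (φ y) ^ δ = q x * q y * dist x y ^ δ) {f g F G : X → ℝ} {p : X × X}
    (hf₁ : F (φ p.1) = (q p.1)⁻¹ * f p.1) (hf₂ : F (φ p.2) = (q p.2)⁻¹ * f p.2)
    (hg₁ : G (φ p.1) = (q p.1)⁻¹ * g p.1) (hg₂ : G (φ p.2) = (q p.2)⁻¹ * g p.2) :
    q p.1 ^ 2 * q p.2 ^ 2 * logIntegrand δ F G (Prod.map φ φ p) =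
      logIntegrand δ f g p + (scaleKernel δ q p * (f p.1 * g p.1) +
        scaleKernel δ q p.swap * (f p.2 * g p.2)) := by
  have h1 := (hq p.1).ne'
  have h2 := (hq p.2).ne'
  simp only [logIntegrand, scaleKernel, Prod.map_fst, Prod.map_snd, Prod.fst_swap, Prod.snd_swap,
    hf₁, hf₂, hg₁, hg₂, hd, dist_comm p.2 p.1]
  -- When the denominator vanishes, every quotient has the value `0`.
  rcases eq_or_ne (dist p.1 p.2 ^ δ) 0 with h0 | h0
  · simp [h0]
  · field_simp
    ring

variable [SecondCountableTopology X] [MeasurableSpace X] [BorelSpace X]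

theorem measurable_scaleKernel (δ : ℝ) {q : X → ℝ} (hq : Measurable q) :
    Measurable (scaleKernel δ q) := by
  have hd : Measurable fun p : X × X => dist p.1 p.2 ^ δ := by fun_prop
  exact (((hq.comp measurable_snd).div (hq.comp measurable_fst)).sub_const 1).div hd

variable {μ : Measure X} [IsFiniteMeasure μ] {φ : X ≃ᵐ X} {q : X → ℝ}

/-- Integrate the pointwise identity `logIntegrand_conformal` over the product. The bounded operator
`m` is multiplication by the integral of `scaleKernel` over its second variable. -/
theorem logForm_conformal {δ : ℝ} (hqm : Measurable q) (hq : ∀ x, 0 < q x)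
    (hd : ∀ x y, dist (φ x) (φ y) ^ δ = q x * q y * dist x y ^ δ)
    (hφ : MeasurePreserving φ (μ.withDensity fun x => ENNReal.ofReal (q x ^ 2)) μ)
    {K : ℝ≥0} (hK : ∀ x, ∫⁻ y, ‖scaleKernel δ q (x, y)‖ₑ ∂μ ≤ K)
    (V : Lp ℝ 2 μ ≃ₗᵢ[ℝ] Lp ℝ 2 μ) (hV : ∀ f, ∀ᵐ x ∂μ, V f (φ x) = (q x)⁻¹ * f x) :
    ∃ (m : Lp ℝ 2 μ →L[ℝ] Lp ℝ 2 μ) (hV : ∀ f, V f ∈ logDomain μ δ ↔ f ∈ logDomain μ δ),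
      ∀ f g : logDomain μ δ, logForm μ δ ⟨V f, (hV f).2 f.2⟩ ⟨V g, (hV g).2 g.2⟩ =
        logForm μ δ f g + ⟪m f, (g : Lp ℝ 2 μ)⟫ := by
  have hκ := measurable_scaleKernel δ hqm
  have hM : Measurable fun x => ∫ y, scaleKernel δ q (x, y) ∂μ :=
    hκ.stronglyMeasurable.integral_prod_right'.measurable
  obtain ⟨m, hm⟩ := exists_mul_operator (μ := μ) hM (norm_integral_kernel_le hK)
  have hfg : ∀ f g : Lp ℝ 2 μ, Integrable (fun x => f x * g x) μ := fun f g =>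
    (Lp.memLp f).integrable_mul (Lp.memLp g)
  have hI : ∀ f g : Lp ℝ 2 μ,
      Integrable (fun p => scaleKernel δ q p * (f p.1 * g p.1)) (μ.prod μ) := fun f g =>
    integrable_kernel_mul hκ hK (hfg f g)
  have hI' : ∀ f g : Lp ℝ 2 μ,
      Integrable (fun p => scaleKernel δ q p.swap * (f p.2 * g p.2)) (μ.prod μ) := fun f g =>
    (hI f g).swap
  have hae : ∀ f g : Lp ℝ 2 μ,
      (fun p => q p.1 ^ 2 * q p.2 ^ 2 * logIntegrand δ (V f) (V g) (Prod.map φ φ p)) =ᵐ[μ.prod μ]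
      fun p => logIntegrand δ f g p + (scaleKernel δ q p * (f p.1 * g p.1) +
        scaleKernel δ q p.swap * (f p.2 * g p.2)) := by
    intro f g
    filter_upwards [Measure.quasiMeasurePreserving_fst.ae (hV f),
      Measure.quasiMeasurePreserving_snd.ae (hV f), Measure.quasiMeasurePreserving_fst.ae (hV g),
      Measure.quasiMeasurePreserving_snd.ae (hV g)] with p h1 h2 h3 h4
    exact logIntegrand_conformal hq hd h1 h2 h3 h4
  have hD : ∀ f, V f ∈ logDomain μ δ ↔ f ∈ logDomain μ δ := by
    intro f
    change Integrable (logIntegrand δ (V f) (V f)) (μ.prod μ) ↔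
      Integrable (logIntegrand δ f f) (μ.prod μ)
    rw [← (changeOfVariables_prod hqm hφ _).1, integrable_congr (hae f f)]
    -- The correction terms are integrable for every `f` in `L²`, so they do not affect membership
    -- in the form domain.
    exact integrable_add_iff_integrable_left ((hI f f).add (hI' f f))
  refine ⟨m, hD, fun f g => ?_⟩
  change 1 / 2 * ∫ p, logIntegrand δ (V f) (V g) p ∂(μ.prod μ) =
    1 / 2 * ∫ p, logIntegrand δ (f : Lp ℝ 2 μ) (g : Lp ℝ 2 μ) p ∂(μ.prod μ) + _
  have hint := integrable_logIntegrand δ (Lp.memLp (f : Lp ℝ 2 μ)).aestronglyMeasurable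
    (Lp.memLp (g : Lp ℝ 2 μ)).aestronglyMeasurable f.2 g.2
  -- The two corrections have equal integrals; their sum absorbs the factor `1 / 2` of the form.
  have hsw : ∫ p, scaleKernel δ q p.swap * ((f : Lp ℝ 2 μ) p.2 * (g : Lp ℝ 2 μ) p.2) ∂(μ.prod μ) =
      ∫ p, scaleKernel δ q p * ((f : Lp ℝ 2 μ) p.1 * (g : Lp ℝ 2 μ) p.1) ∂(μ.prod μ) :=
    integral_prod_swap fun p =>
      scaleKernel δ q p * ((f : Lp ℝ 2 μ) p.1 * (g : Lp ℝ 2 μ) p.1)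
  have hin : ⟪m f, (g : Lp ℝ 2 μ)⟫ =
      ∫ x, (∫ y, scaleKernel δ q (x, y) ∂μ) * ((f : Lp ℝ 2 μ) x * (g : Lp ℝ 2 μ) x) ∂μ := by
    rw [L2.inner_def]
    refine integral_congr_ae ?_
    filter_upwards [hm f] with x hx
    simp only [hx, RCLike.inner_apply, conj_trivial]
    ring
  have hadd := integral_add hint ((hI f g).add (hI' f g))
  rw [integral_add' (hI f g) (hI' f g), hsw, integral_kernel_mul hκ hK (hfg f g), ← hin] at hadd
  rw [← (changeOfVariables_prod hqm hφ _).2, integral_congr_ae (hae f g)]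
  refine (congrArg (fun r : ℝ => 1 / 2 * r) hadd).trans ?_
  ring

/-- A unitary induced by a conformal map commutes with the logarithmic Dirichlet Laplacian up to a
bounded operator, provided that the sections of `scaleKernel` are uniformly integrable. -/
theorem logLaplacian_commutator {δ : ℝ} (hD : Dense (logDomain μ δ : Set (Lp ℝ 2 μ)))
    (hqm : Measurable q) (hq : ∀ x, 0 < q x)
    (hd : ∀ x y, dist (φ x) (φ y) ^ δ = q x * q y * dist x y ^ δ)
    (hφ : MeasurePreserving φ (μ.withDensity fun x => ENNReal.ofReal (q x ^ 2)) μ)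
    {K : ℝ≥0} (hK : ∀ x, ∫⁻ y, ‖scaleKernel δ q (x, y)‖ₑ ∂μ ≤ K)
    (V : Lp ℝ 2 μ ≃ₗᵢ[ℝ] Lp ℝ 2 μ) (hV : ∀ f, ∀ᵐ x ∂μ, V f (φ x) = (q x)⁻¹ * f x) :
    (∀ f ∈ (logLaplacian μ δ).domain, V f ∈ (logLaplacian μ δ).domain) ∧
    ∃ B : Lp ℝ 2 μ →L[ℝ] Lp ℝ 2 μ, ∀ (f : (logLaplacian μ δ).domain)
      (hf : V (f : Lp ℝ 2 μ) ∈ (logLaplacian μ δ).domain),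
      logLaplacian μ δ ⟨V (f : Lp ℝ 2 μ), hf⟩ - V (logLaplacian μ δ f) = B f := by
  obtain ⟨m, hV', hm⟩ := logForm_conformal hqm hq hd hφ hK V hV
  obtain ⟨h1, h2⟩ := formOperator_commutator hD V m hV' hm
  exact ⟨h1, (V.toContinuousLinearEquiv : Lp ℝ 2 μ →L[ℝ] Lp ℝ 2 μ) ∘L m, h2⟩

end Conformal

/-! ### Lorentz action, cocycle and distances on the sphere. -/

section Action

variable {n : ℕ}

theorem norm_coe_sphere (x : S n) : ‖(x : E n)‖ = 1 := mem_sphere_zero_iff_norm.mp x.2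

/-- The time component of `γ (x, 1)`, which is the inverse of `|γ'(x)|`. -/
noncomputable def boost (γ : SOPlus n) (x : S n) : ℝ := timePart (mat γ) x 1

theorem boost_pos (γ : SOPlus n) (x : S n) : 0 < boost γ x :=
  timePart_pos γ.2.1 γ.2.2 one_pos (norm_coe_sphere x).le

theorem scale_eq (hn : 1 ≤ n) (γ : SOPlus n) (x : S n) : scale γ x = (boost γ x)⁻¹ :=
  IsScale.unique hn (exists_isScale γ x).choose_spec (isScale_sphereAct γ x)

theorem boost_smul_sphereAct (γ : SOPlus n) (x : S n) :
    boost γ x • (sphereAct γ x : E n) = spacePart (mat γ) x 1 := by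
  rw [coe_sphereAct, smul_smul, ← boost, mul_inv_cancel₀ (boost_pos γ x).ne', one_smul]

theorem spacePart_mul (A B : Mat n) (p : E n) (s : ℝ) :
    spacePart (A * B) p s = spacePart A (spacePart B p s) (timePart B p s) := by
  ext i
  simp only [spacePart, timePart, ← Matrix.mulVec_mulVec]
  rw [← col_parts B]
  rfl

theorem timePart_mul (A B : Mat n) (p : E n) (s : ℝ) :
    timePart (A * B) p s = timePart A (spacePart B p s) (timePart B p s) := by
  simp only [spacePart, timePart, ← Matrix.mulVec_mulVec]
  rw [← col_parts B]
  rfl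

/-- The chain rule in linear form: apply `γ` to `γ' (x, 1) = b'(x) (γ' x, 1)` and use homogeneity.
-/
theorem boost_mul (γ γ' : SOPlus n) (x : S n) :
    boost (γ * γ') x = boost γ' x * boost γ (sphereAct γ' x) := by
  have h : mat (γ * γ') = mat γ * mat γ' := rfl
  rw [boost, h, timePart_mul, ← boost_smul_sphereAct]
  conv_lhs => rw [show timePart (mat γ') x 1 = boost γ' x * 1 from (mul_one _).symm]
  exact timePart_smul _ _ _ _

theorem sphereAct_mul (γ γ' : SOPlus n) (x : S n) :
    sphereAct (γ * γ') x = sphereAct γ (sphereAct γ' x) := by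
  have h : mat (γ * γ') = mat γ * mat γ' := rfl
  have h1 := boost_smul_sphereAct (γ * γ') x
  rw [h, spacePart_mul, ← boost_smul_sphereAct γ',
    show timePart (mat γ') x 1 = boost γ' x * 1 from (mul_one _).symm, spacePart_smul,
    ← boost_smul_sphereAct, smul_smul, ← boost_mul] at h1
  exact Subtype.ext (smul_right_injective _ (boost_pos (γ * γ') x).ne' h1)

theorem mat_one : mat (1 : SOPlus n) = 1 := rfl

theorem boost_one (x : S n) : boost 1 x = 1 := by
  simp [boost, mat_one, timePart, col]

theorem sphereAct_one (x : S n) : sphereAct 1 x = x := by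
  have h := boost_smul_sphereAct 1 x
  rw [boost_one, one_smul] at h
  refine Subtype.ext (h.trans ?_)
  ext i
  simp [mat_one, spacePart, col]

theorem sphereAct_inv_sphereAct (γ : SOPlus n) (x : S n) : sphereAct γ⁻¹ (sphereAct γ x) = x := by
  rw [← sphereAct_mul, inv_mul_cancel, sphereAct_one]

theorem sphereAct_sphereAct_inv (γ : SOPlus n) (x : S n) : sphereAct γ (sphereAct γ⁻¹ x) = x := by
  rw [← sphereAct_mul, mul_inv_cancel, sphereAct_one]

theorem dist_sq_sphere (x y : S n) : dist x y ^ 2 = 2 * (1 - ⟪(x : E n), y⟫) := by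
  rw [Subtype.dist_eq, dist_eq_norm, norm_sub_sq_real, norm_coe_sphere, norm_coe_sphere]
  ring

theorem dist_le_two_sphere (x y : S n) : dist x y ≤ 2 := by
  have h := dist_triangle (x : E n) 0 y
  rw [dist_zero_right, dist_zero_left, norm_coe_sphere, norm_coe_sphere] at h
  rw [Subtype.dist_eq]
  linarith

/-- The Lorentz product of `(x, 1)` and `(y, 1)` is `⟪x, y⟫ - 1 = -d(x, y)² / 2`, and `γ` preserves
it while rescaling the two images by their boosts. -/
theorem dist_sq_sphereAct (γ : SOPlus n) (x y : S n) :
    boost γ x * boost γ y * dist (sphereAct γ x) (sphereAct γ y) ^ 2 = dist x y ^ 2 := by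
  have h := inner_parts γ.2.1 (x : E n) y 1 1
  change ⟪spacePart (mat γ) x 1, spacePart (mat γ) y 1⟫ - boost γ x * boost γ y = _ at h
  rw [← boost_smul_sphereAct, ← boost_smul_sphereAct, real_inner_smul_left,
    real_inner_smul_right] at h
  rw [dist_sq_sphere, dist_sq_sphere]
  linear_combination -2 * h

theorem continuous_sphereAct (γ : SOPlus n) : Continuous (sphereAct γ) :=
  (mdifferentiable_sphereAct γ).continuous

/-- The action of an element of `SO⁺(n+1,1)` on the sphere as a measurable equivalence. -/
noncomputable def sphereEquiv (γ : SOPlus n) : S n ≃ᵐ S n where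
  toFun := sphereAct γ
  invFun := sphereAct γ⁻¹
  left_inv := sphereAct_inv_sphereAct γ
  right_inv := sphereAct_sphereAct_inv γ
  measurable_toFun := (continuous_sphereAct γ).measurable
  measurable_invFun := (continuous_sphereAct γ⁻¹).measurable

/-- The boost is the restriction of an affine function on `ℝⁿ⁺¹`; hence it is Lipschitz for the
chordal distance. -/
theorem boost_sub (γ : SOPlus n) (x y : S n) :
    boost γ x - boost γ y = timeLin (mat γ) ((x : E n) - y) := by
  have h : ∀ z : E n, timePart (mat γ) z 1 = timeLin (mat γ) z + timePart (mat γ) 0 1 := fun z => by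
    have h : col z 1 = col z 0 + col 0 1 := by ext (i | i) <;> simp [col]
    change _ = timePart (mat γ) z 0 + _
    simp [timePart, h, Matrix.mulVec_add]
  rw [boost, boost, h x, h y, map_sub]
  ring

theorem abs_boost_sub_le (γ : SOPlus n) (x y : S n) :
    |boost γ x - boost γ y| ≤ ‖timeLin (mat γ)‖ * dist x y := by
  rw [boost_sub, Subtype.dist_eq, dist_eq_norm]
  exact (timeLin (mat γ)).le_opNorm _

theorem continuous_boost (γ : SOPlus n) : Continuous (boost γ) := by
  refine (LipschitzWith.of_dist_le_mul (K := ‖timeLin (mat γ)‖₊) fun x y => ?_).continuous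
  exact abs_boost_sub_le γ x y

end Action

/-! ### The action on the light cone and its Jacobian. -/

section ConeMap

variable {n : ℕ}

/-- The action of `γ` on the future light cone, parametrized by its space component. -/
noncomputable def coneMap (γ : SOPlus n) (p : E n) : E n := spacePart (mat γ) p ‖p‖

theorem norm_coneMap (γ : SOPlus n) (p : E n) : ‖coneMap γ p‖ = timePart (mat γ) p ‖p‖ := by
  rcases eq_or_ne p 0 with rfl | hp
  · simp [coneMap, timePart, spacePart, col, Matrix.mulVec, dotProduct, EuclideanSpace.norm_eq]
  have h1 := inner_parts γ.2.1 p p ‖p‖ ‖p‖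
  have h2 := timePart_pos γ.2.1 γ.2.2 (norm_pos_iff.2 hp) le_rfl
  rw [real_inner_self_eq_norm_sq, real_inner_self_eq_norm_sq] at h1
  exact (sq_eq_sq₀ (norm_nonneg _) h2.le).1 (by rw [coneMap]; linarith)

theorem coneMap_mul (γ γ' : SOPlus n) (p : E n) :
    coneMap (γ * γ') p = coneMap γ (coneMap γ' p) := by
  have h : mat (γ * γ') = mat γ * mat γ' := rfl
  rw [coneMap, h, spacePart_mul, ← norm_coneMap]
  rfl

theorem coneMap_one (p : E n) : coneMap 1 p = p := by
  ext i
  simp [coneMap, mat_one, spacePart, col]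

theorem coneMap_zero (γ : SOPlus n) : coneMap γ 0 = 0 := by
  ext i
  simp [coneMap, spacePart, col, Matrix.mulVec, dotProduct]

theorem bijective_coneMap (γ : SOPlus n) : Function.Bijective (coneMap γ) := by
  refine Function.bijective_iff_has_inverse.2 ⟨coneMap γ⁻¹, fun p => ?_, fun p => ?_⟩
  · rw [← coneMap_mul, inv_mul_cancel, coneMap_one]
  · rw [← coneMap_mul, mul_inv_cancel, coneMap_one]

theorem coneMap_image_compl_zero (γ : SOPlus n) : coneMap γ '' {0}ᶜ = {0}ᶜ := by
  rw [Set.image_compl_eq (bijective_coneMap γ), Set.image_singleton, coneMap_zero]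

/-- In polar coordinates the cone action is `(r, x) ↦ (r b(x), γ x)`, which links Lebesgue measure
to the action on the sphere. -/
theorem coneMap_smul (γ : SOPlus n) (x : S n) {r : ℝ} (hr : 0 < r) :
    coneMap γ (r • (x : E n)) = (r * boost γ x) • (sphereAct γ x : E n) := by
  rw [coneMap, norm_smul, Real.norm_of_nonneg hr.le, norm_coe_sphere, spacePart_smul, mul_smul,
    boost_smul_sphereAct]

/-- A map whose Gram matrix is `1 - x xᵀ + τ τᵀ` for a unit vector `x` has determinant `± ⟪τ, x⟫`. -/
theorem det_sq_of_gram (M : E n →ₗ[ℝ] E n) {x τ : E n} (hx : ‖x‖ = 1)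
    (h : ∀ v w, ⟪M v, M w⟫ = ⟪v, w⟫ - ⟪x, v⟫ * ⟪x, w⟫ + ⟪τ, v⟫ * ⟪τ, w⟫) :
    LinearMap.det M ^ 2 = ⟪τ, x⟫ ^ 2 := by
  set b := (EuclideanSpace.basisFun (Fin (n + 1)) ℝ).toBasis
  set A := LinearMap.toMatrix b b M with hA
  set P : Matrix (Fin (n + 1)) (Fin 2) ℝ := Matrix.of fun i => ![-x i, τ i] with hP
  set R : Matrix (Fin 2) (Fin (n + 1)) ℝ := Matrix.of ![fun i => x i, fun i => τ i] with hR
  -- The Gram matrix is the identity plus a matrix of rank at most two, factored through `ℝ²`.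
  have hgram : Aᵀ * A = 1 + P * R := by
    ext i j
    have hij := h (EuclideanSpace.single i 1) (EuclideanSpace.single j 1)
    have e1 : (Aᵀ * A) i j =
        ⟪M (EuclideanSpace.single i 1), M (EuclideanSpace.single j 1)⟫ := by
      simp [hA, b, Matrix.mul_apply, LinearMap.toMatrix_apply, PiLp.inner_apply, mul_comm]
    rw [e1, hij]
    simp [hP, hR, Matrix.mul_apply, Matrix.one_apply, EuclideanSpace.inner_single_right, Fin.sum_univ_two, eq_comm]
    ring
  have hxx : ∑ i, x i * x i = 1 := by
    have := real_inner_self_eq_norm_sq x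
    rw [hx, PiLp.inner_apply] at this
    simpa [sq] using this
  have hxτ : ∑ i, x i * τ i = ⟪τ, x⟫ := by
    simp [PiLp.inner_apply]
  have hτx : ∑ i, τ i * x i = ⟪τ, x⟫ := by
    simp [PiLp.inner_apply, mul_comm]
  rw [← LinearMap.det_toMatrix b M, ← hA, sq]
  have hdet := congrArg Matrix.det hgram
  -- Sylvester's identity replaces `1 + P R` by the `2 × 2` matrix `1 + R P`. Its first diagonal
  -- entry is `1 - ‖x‖² = 0`, so only the off-diagonal product `⟪τ, x⟫ · (-⟪τ, x⟫)` matters.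
  rw [Matrix.det_mul, Matrix.det_transpose, Matrix.det_one_add_mul_comm, Matrix.det_fin_two] at hdet
  have e00 : (R * P) 0 0 = -∑ i, x i * x i := by
    rw [Matrix.mul_apply, ← Finset.sum_neg_distrib]
    simp [hP, hR]
  have e01 : (R * P) 0 1 = ∑ i, x i * τ i := by
    rw [Matrix.mul_apply]
    simp [hP, hR]
  have e10 : (R * P) 1 0 = -∑ i, τ i * x i := by
    rw [Matrix.mul_apply, ← Finset.sum_neg_distrib]
    simp [hP, hR]
  rw [hxx] at e00
  rw [hxτ] at e01
  rw [hτx] at e10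
  rw [hdet]
  simp only [Matrix.add_apply, e00, e01, e10, Matrix.one_apply_eq, ne_eq, zero_ne_one, one_ne_zero,
    not_false_eq_true, Matrix.one_apply_ne]
  ring

/-- The derivative of `coneMap γ` at the positive multiples of the unit vector `x`. -/
noncomputable def coneDeriv (γ : SOPlus n) (x : E n) : E n →L[ℝ] E n :=
  spaceLin (mat γ) + (innerSL ℝ x).smulRight (spacePart (mat γ) 0 1)

theorem spacePart_eq (A : Mat n) (p : E n) (s : ℝ) :
    spacePart A p s = spaceLin A p + s • spacePart A 0 1 := by
  have h : col p s = col p 0 + s • col 0 1 := by ext (i | i) <;> simp [col]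
  ext i
  change spacePart A p s i = (spacePart A p 0 + s • spacePart A 0 1) i
  simp [spacePart, h, Matrix.mulVec_add, Matrix.mulVec_smul]

theorem coneDeriv_apply (γ : SOPlus n) (x v : E n) :
    coneDeriv γ x v = spacePart (mat γ) v ⟪x, v⟫ := by
  rw [spacePart_eq]
  simp [coneDeriv]

theorem hasFDerivAt_coneMap (γ : SOPlus n) {p : E n} (hp : p ≠ 0) :
    HasFDerivAt (coneMap γ) (coneDeriv γ (‖p‖⁻¹ • p)) p := by
  have h : coneMap γ = fun p => spaceLin (mat γ) p + ‖p‖ • spacePart (mat γ) 0 1 :=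
    funext fun p => spacePart_eq _ _ _
  have hnorm : HasFDerivAt (fun q : E n => ‖q‖) (innerSL ℝ (‖p‖⁻¹ • p)) p := by
    have h1 := (hasStrictFDerivAt_norm_sq p).hasFDerivAt.sqrt (by positivity)
    simp only [Real.sqrt_sq (norm_nonneg _)] at h1
    refine h1.congr_fderiv ?_
    ext v
    simp
    field_simp
  rw [h]
  exact (spaceLin (mat γ)).hasFDerivAt.add (hnorm.smul_const _)

/-- The derivative is the space part of `γ (v, ⟪x, v⟫)`. Lorentz invariance computes its Gram form,
with `τ` representing the time part, and `⟪τ, x⟫` is the boost. Equivalently, `dp / ‖p‖` is an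
invariant measure on the cone. -/
theorem abs_det_coneDeriv (γ : SOPlus n) (x : S n) :
    |(coneDeriv γ x).det| = boost γ x := by
  set τ : E n := (InnerProductSpace.toDual ℝ (E n)).symm
    (timeLin (mat γ) + timePart (mat γ) 0 1 • innerSL ℝ (x : E n)) with hτ
  have hτ' : ∀ v, ⟪τ, v⟫ = timePart (mat γ) v ⟪(x : E n), v⟫ := fun v => by
    have h : col v ⟪(x : E n), v⟫ = col v 0 + ⟪(x : E n), v⟫ • col 0 1 := by
      ext (i | i) <;> simp [col]
    rw [hτ, InnerProductSpace.toDual_symm_apply]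
    change timePart (mat γ) v 0 + timePart (mat γ) 0 1 * ⟪(x : E n), v⟫ = _
    simp [timePart, h, Matrix.mulVec_add, Matrix.mulVec_smul, mul_comm]
  have h := det_sq_of_gram (coneDeriv γ x : E n →ₗ[ℝ] E n) (norm_coe_sphere x) (τ := τ)
    fun v w => by
      rw [ContinuousLinearMap.coe_coe, coneDeriv_apply, coneDeriv_apply, hτ', hτ']
      have := inner_parts γ.2.1 v w ⟪(x : E n), v⟫ ⟪(x : E n), w⟫
      linarith
  have hb : ⟪τ, (x : E n)⟫ = boost γ x := by
    rw [hτ', real_inner_self_eq_norm_sq, norm_coe_sphere, one_pow, boost]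
  rw [hb] at h
  rw [← abs_of_pos (boost_pos γ x)]
  exact (sq_eq_sq_iff_abs_eq_abs _ _).1 h

end ConeMap

/-! ### Polar coordinates and the change of measure on the sphere. -/

section Polar

variable {n : ℕ}

/-- Integration in polar coordinates. -/
theorem lintegral_polar {G : E n → ℝ≥0∞} (hG : Measurable G) :
    ∫⁻ p, G p = ∫⁻ y : S n, (∫⁻ r in Set.Ioi (0 : ℝ), ENNReal.ofReal (r ^ n) * G (r • (y : E n)))
      ∂(sphereMeasure n) := by
  have h := (volume : Measure (E n)).measurePreserving_homeomorphUnitSphereProd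
  have hm : Measurable fun z : S n × Set.Ioi (0 : ℝ) => G (z.2.1 • (z.1 : E n)) := by fun_prop
  have h1 : ∫⁻ p, G p = ∫⁻ p : ({0}ᶜ : Set (E n)), G p ∂((volume : Measure (E n)).comap Subtype.val) := by
    rw [lintegral_subtype_comap (measurableSet_singleton _).compl, restrict_compl_singleton]
  have h2 : ∀ p : ({0}ᶜ : Set (E n)), G p = G ((homeomorphUnitSphereProd (E n) p).2.1 •
      ((homeomorphUnitSphereProd (E n) p).1 : E n)) := fun p => by
    congr 1
    exact congrArg Subtype.val ((homeomorphUnitSphereProd (E n)).symm_apply_apply p).symm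
  rw [h1, lintegral_congr h2, h.lintegral_comp hm, lintegral_prod _ hm.aemeasurable]
  refine lintegral_congr fun y => ?_
  have hd : finrank ℝ (E n) - 1 = n := by simp
  rw [Measure.volumeIoiPow, hd, lintegral_withDensity_eq_lintegral_mul₀ (by fun_prop) (by fun_prop)]
  exact lintegral_subtype_comap measurableSet_Ioi
    fun r : ℝ => ENNReal.ofReal (r ^ n) * G (r • (y : E n))

theorem lintegral_pow_indicator (n : ℕ) {c : ℝ} (hc : 0 < c) :
    ∫⁻ r in Set.Ioi (0 : ℝ), ENNReal.ofReal (r ^ n) * (Set.Iio c).indicator 1 r =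
      ENNReal.ofReal (c ^ (n + 1) / (n + 1)) := by
  have h := Measure.volumeIoiPow_apply_Iio n ⟨c, hc⟩
  rw [← h, Measure.volumeIoiPow, withDensity_apply _ measurableSet_Iio,
    setLIntegral_subtype measurableSet_Ioi _ fun a : ℝ => ENNReal.ofReal (a ^ n)]
  have : (Subtype.val '' Set.Iio (⟨c, hc⟩ : Set.Ioi (0 : ℝ))) = Set.Ioi 0 ∩ Set.Iio c := by
    ext r
    simp
  rw [this, Set.inter_comm, ← Measure.restrict_restrict measurableSet_Iio,
    ← lintegral_indicator measurableSet_Iio]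
  refine lintegral_congr fun r => ?_
  by_cases hr : r < c <;> simp [hr]

/-- The radial projection of `ℝⁿ⁺¹` onto the sphere, with an arbitrary value at the origin. -/
noncomputable def sphereProj (p : E n) : S n :=
  ⟨if p = 0 then EuclideanSpace.single 0 1 else ‖p‖⁻¹ • p, by
    rw [mem_sphere_zero_iff_norm]
    split_ifs with h
    · simp
    · rw [norm_smul, norm_inv, norm_norm, inv_mul_cancel₀ (norm_ne_zero_iff.2 h)]⟩

theorem measurable_sphereProj : Measurable (sphereProj (n := n)) := by
  refine Measurable.subtype_mk (Measurable.ite ?_ measurable_const (by fun_prop))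
  exact measurableSet_singleton (0 : E n)

theorem sphereProj_smul {r : ℝ} (hr : 0 < r) (y : S n) : sphereProj (r • (y : E n)) = y := by
  have hy : (y : E n) ≠ 0 := norm_ne_zero_iff.1 (by rw [norm_coe_sphere]; exact one_ne_zero)
  refine Subtype.ext ?_
  rw [sphereProj]
  simp only [smul_eq_zero, hr.ne', hy, or_self, if_false]
  rw [norm_smul, norm_coe_sphere, Real.norm_of_nonneg hr.le, mul_one, smul_smul,
    inv_mul_cancel₀ hr.ne', one_smul]

/-- Extend `F` radially to the unit ball and change variables by `coneMap γ`. On the ray through `y`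
the preimage of the ball is `r < 1 / b(y)`, so the Jacobian `b` and the radial integral give `b · b
^ (-(n + 1)) / (n + 1) = b ^ (-n) / (n + 1)`. -/
theorem lintegral_boost (γ : SOPlus n) {F : S n → ℝ≥0∞} (hF : Measurable F) :
    ∫⁻ y, ENNReal.ofReal ((boost γ y)⁻¹ ^ n) * F (sphereAct γ y) ∂(sphereMeasure n) =
      ∫⁻ y, F y ∂(sphereMeasure n) := by
  set G : E n → ℝ≥0∞ := fun p => (Set.Iio 1).indicator 1 ‖p‖ * F (sphereProj p) with hG
  have hGm : Measurable G :=
    ((measurable_one.indicator measurableSet_Iio).comp measurable_norm).mul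
      (hF.comp measurable_sphereProj)
  have hb := continuous_boost γ
  -- The radial integral of `r ^ n` over `(0, 1)`; it appears on both sides and is cancelled at the
  -- end.
  set c : ℝ≥0∞ := ENNReal.ofReal (1 / (n + 1)) with hc
  have h1 : ∫⁻ p, G p = (∫⁻ y, F y ∂(sphereMeasure n)) * c := by
    rw [lintegral_polar hGm, ← lintegral_mul_const _ hF]
    refine lintegral_congr fun y => ?_
    have h2 := lintegral_pow_indicator n one_pos
    rw [one_pow] at h2
    rw [hc, ← h2, ← lintegral_const_mul _ (by
      exact Measurable.mul (by fun_prop) (measurable_one.indicator measurableSet_Iio))]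
    refine setLIntegral_congr_fun measurableSet_Ioi fun r (hr : 0 < r) => ?_
    simp only [hG, sphereProj_smul hr, norm_smul, norm_coe_sphere, mul_one,
      Real.norm_of_nonneg hr.le]
    ring
  set G' : E n → ℝ≥0∞ := fun p => ENNReal.ofReal (boost γ (sphereProj p)) * G (coneMap γ p) with hG'
  have hcm : Measurable (coneMap γ) := by
    have : coneMap γ = fun p => spaceLin (mat γ) p + ‖p‖ • spacePart (mat γ) 0 1 :=
      funext fun p => spacePart_eq _ _ _
    rw [this]
    fun_prop
  have hGm' : Measurable G' :=
    (hb.measurable.comp measurable_sphereProj).ennreal_ofReal.mul (hGm.comp hcm)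
  have h2 : ∫⁻ p, G p = ∫⁻ p, G' p := by
    have h3 := lintegral_image_eq_lintegral_abs_det_fderiv_mul volume
      (measurableSet_singleton (0 : E n)).compl
      (fun p hp => (hasFDerivAt_coneMap γ hp).hasFDerivWithinAt)
      (bijective_coneMap γ).1.injOn G
    rw [coneMap_image_compl_zero, restrict_compl_singleton] at h3
    rw [h3, ← restrict_compl_singleton (μ := (volume : Measure (E n))) 0]
    refine setLIntegral_congr_fun (measurableSet_singleton _).compl fun p (hp : p ≠ 0) => ?_
    have h4 : ‖p‖⁻¹ • p = sphereProj p := by simp [sphereProj, hp]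
    simp only [hG', h4, abs_det_coneDeriv]
  have h3 : ∫⁻ p, G' p = (∫⁻ y, ENNReal.ofReal ((boost γ y)⁻¹ ^ n) * F (sphereAct γ y)
      ∂(sphereMeasure n)) * c := by
    have hm : Measurable fun y => ENNReal.ofReal ((boost γ y)⁻¹ ^ n) * F (sphereAct γ y) :=
      (hb.measurable.inv.pow_const n).ennreal_ofReal.mul
        (hF.comp (continuous_sphereAct γ).measurable)
    rw [lintegral_polar hGm', ← lintegral_mul_const _ hm]
    refine lintegral_congr fun y => ?_
    have hy := boost_pos γ y
    have h4 := lintegral_pow_indicator n (inv_pos.2 hy)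
    have h5 : ENNReal.ofReal ((boost γ y)⁻¹ ^ n) * F (sphereAct γ y) * c =
        ENNReal.ofReal (boost γ y) * F (sphereAct γ y) *
          ENNReal.ofReal ((boost γ y)⁻¹ ^ (n + 1) / (n + 1)) := by
      rw [hc, mul_right_comm, mul_right_comm (ENNReal.ofReal (boost γ y)), ← ENNReal.ofReal_mul (by positivity),
        ← ENNReal.ofReal_mul hy.le]
      congr 2
      rw [pow_succ]
      field_simp
    rw [h5, ← h4, ← lintegral_const_mul _ (by
      exact Measurable.mul (by fun_prop) (measurable_one.indicator measurableSet_Iio))]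
    refine setLIntegral_congr_fun measurableSet_Ioi fun r (hr : 0 < r) => ?_
    have h6 : (Set.Iio (1 : ℝ)).indicator (1 : ℝ → ℝ≥0∞) (r * boost γ y) =
        (Set.Iio (boost γ y)⁻¹).indicator 1 r := by
      have : r * boost γ y < 1 ↔ r < (boost γ y)⁻¹ := by
        rw [← one_div, lt_div_iff₀ hy]
      simp only [Set.indicator, Set.mem_Iio, this, Pi.one_apply]
    have hrb : 0 < r * boost γ y := mul_pos hr hy
    simp only [hG', hG, sphereProj_smul hr, coneMap_smul γ y hr, sphereProj_smul hrb, norm_smul,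
      norm_coe_sphere, mul_one, Real.norm_of_nonneg hrb.le, h6]
    ring
  have hc0 : c ≠ 0 := by
    rw [hc, Ne, ENNReal.ofReal_eq_zero, not_le]
    positivity
  exact (ENNReal.mul_left_inj hc0 ENNReal.ofReal_ne_top).1 (h3.symm.trans (h2.symm.trans h1))

/-- The action scales the measure by the `n`-th power of the conformal factor. -/
theorem measurePreserving_sphereEquiv (γ : SOPlus n) :
    MeasurePreserving (sphereEquiv γ)
      ((sphereMeasure n).withDensity fun x => ENNReal.ofReal ((boost γ x)⁻¹ ^ n))
      (sphereMeasure n) := by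
  refine ⟨(sphereEquiv γ).measurable, Measure.ext fun s hs => ?_⟩
  have hs' := (sphereEquiv γ).measurable hs
  have h := lintegral_boost γ (F := s.indicator 1) (measurable_one.indicator hs)
  rw [lintegral_indicator_one hs] at h
  rw [Measure.map_apply (sphereEquiv γ).measurable hs, withDensity_apply _ hs', ← h,
    ← lintegral_indicator hs']
  refine lintegral_congr fun y => ?_
  by_cases hy : sphereAct γ y ∈ s
  · rw [Set.indicator_of_mem (show y ∈ sphereEquiv γ ⁻¹' s from hy), Set.indicator_of_mem hy,
      Pi.one_apply, mul_one]
  · rw [Set.indicator_of_notMem (show y ∉ sphereEquiv γ ⁻¹' s from hy), Set.indicator_of_notMem hy,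
      mul_zero]

/-- The density is everywhere positive, so `μ` is absolutely continuous with respect to the weighted
measure. This lets almost-everywhere identities be composed with the action. -/
theorem quasiMeasurePreserving_sphereAct (γ : SOPlus n) :
    Measure.QuasiMeasurePreserving (sphereAct γ) (sphereMeasure n) (sphereMeasure n) := by
  have h := (measurePreserving_sphereEquiv γ).quasiMeasurePreserving
  refine ⟨h.1, (Measure.AbsolutelyContinuous.map ?_ h.1).trans h.2⟩
  refine withDensity_absolutelyContinuous' ?_ (Filter.Eventually.of_forall fun x => ?_)
  · exact ((continuous_boost γ).measurable.inv.pow_const n).ennreal_ofReal.aemeasurable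
  · have := boost_pos γ x
    simpa using by positivity

end Polar

/-! ### Uniform integrability of `d ^ (1 - n)`. -/

section KernelBound

variable {n : ℕ}

/-- On the sphere of dimension `n` the kernel `d(x, y) ^ (1 - n)` is integrable in `y`, uniformly
in `x`. -/
theorem exists_lintegral_dist_le (n : ℕ) :
    ∃ K : ℝ≥0, ∀ x : S n,
      ∫⁻ y, ENNReal.ofReal (dist x y / dist x y ^ n) ∂(sphereMeasure n) ≤ K := by
  -- Instead of coordinates on the sphere, `‖p‖ ^ (-n)` is integrated over a ball in `ℝⁿ⁺¹`, where
  -- the polar factor `r ^ n` cancels it. Translating by `x` gives a bound independent of `x`.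
  -- Radius `3` suffices because the points used below lie within `5/4 · 2` of `x`.
  set H : E n → ℝ≥0∞ := fun p => (Set.Iio 3).indicator (fun r => ENNReal.ofReal (r ^ n)⁻¹) ‖p‖ with hH
  have hHm : Measurable H :=
    (Measurable.indicator (by fun_prop) measurableSet_Iio).comp measurable_norm
  have hfin : ∫⁻ p, H p ≠ ⊤ := by
    rw [lintegral_polar hHm]
    have h1 : ∀ y : S n, ∫⁻ r in Set.Ioi (0 : ℝ), ENNReal.ofReal (r ^ n) * H (r • (y : E n)) ≤ 3 := by
      intro y
      calc _ = ∫⁻ r in Set.Ioi (0 : ℝ), (Set.Iio 3).indicator 1 r := by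
            refine setLIntegral_congr_fun measurableSet_Ioi fun r (hr : 0 < r) => ?_
            simp only [hH, norm_smul, norm_coe_sphere, mul_one, Real.norm_of_nonneg hr.le]
            by_cases h3 : r ∈ Set.Iio 3
            · rw [Set.indicator_of_mem h3, Set.indicator_of_mem h3,
                ← ENNReal.ofReal_mul (by positivity), mul_inv_cancel₀ (by positivity)]
              simp
            · rw [Set.indicator_of_notMem h3, Set.indicator_of_notMem h3, mul_zero]
        _ = volume (Set.Iio (3 : ℝ) ∩ Set.Ioi 0) := by
            rw [lintegral_indicator_one measurableSet_Iio,
              Measure.restrict_apply measurableSet_Iio]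
        _ ≤ 3 := by
            rw [Set.inter_comm, Set.Ioi_inter_Iio, Real.volume_Ioo]
            simp
    refine ne_top_of_le_ne_top ?_ (lintegral_mono h1)
    rw [lintegral_const]
    exact ENNReal.mul_ne_top (by simp) (measure_ne_top _ _)
  -- On a radial segment of length `ρ / 4` the integrand is at least `(1/2) ^ n (5ρ/4) ^ (-n) =
  -- (2/5) ^ n ρ ^ (-n)`; the product is `c ρ / ρ ^ n`.
  set c : ℝ := (2 / 5) ^ n / 4 with hc
  have hc0 : 0 < c := by positivity
  refine ⟨(ENNReal.ofReal c⁻¹ * ∫⁻ p, H p).toNNReal, fun x => ?_⟩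
  rw [ENNReal.coe_toNNReal (ENNReal.mul_ne_top ENNReal.ofReal_ne_top hfin)]
  have hshift : ∫⁻ p, H p = ∫⁻ p, H ((x : E n) - p) :=
    (lintegral_sub_left_eq_self H (x : E n)).symm
  have hm : Measurable fun p => H ((x : E n) - p) := hHm.comp (by fun_prop)
  rw [hshift, lintegral_polar hm, ← lintegral_const_mul' _ _ ENNReal.ofReal_ne_top]
  refine lintegral_mono fun y => ?_
  -- On the diagonal the numerator `dist x y` is `0`, so nothing has to be bounded.
  rcases eq_or_ne x y with rfl | hxy
  · simp
  set ρ := dist x y with hρ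
  have hρ0 : 0 < ρ := dist_pos.2 hxy
  have hρ2 : ρ ≤ 2 := dist_le_two_sphere x y
  have hlow : ∀ r ∈ Set.Ioo (1 - ρ / 4) 1, ENNReal.ofReal ((2 / 5) ^ n / ρ ^ n) ≤
      ENNReal.ofReal (r ^ n) * H ((x : E n) - r • (y : E n)) := by
    rintro r ⟨hr1, hr2⟩
    have hr0 : 1 / 2 ≤ r := by linarith
    have hle : ‖(x : E n) - r • (y : E n)‖ ≤ 5 / 4 * ρ := by
      have h1 : (x : E n) - r • (y : E n) = (x - y : E n) + (1 - r) • (y : E n) := by module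
      have h2 := norm_add_le (x - y : E n) ((1 - r) • (y : E n))
      rw [norm_smul, norm_coe_sphere, Real.norm_of_nonneg (by linarith), ← dist_eq_norm,
        ← Subtype.dist_eq] at h2
      rw [h1]
      linarith
    -- Needed to invert the upper bound `hle`; it uses `r < 1`, which is why the segment stays
    -- inside the sphere.
    have hpos : 0 < ‖(x : E n) - r • (y : E n)‖ := by
      have h2 := norm_sub_norm_le (x : E n) (r • (y : E n))
      rw [norm_smul, norm_coe_sphere, norm_coe_sphere, Real.norm_of_nonneg (by linarith)] at h2
      linarith
    simp only [hH]
    rw [Set.indicator_of_mem (show ‖(x : E n) - r • (y : E n)‖ ∈ Set.Iio 3 from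
      hle.trans_lt (by linarith)), ← ENNReal.ofReal_mul (by positivity)]
    refine ENNReal.ofReal_le_ofReal ?_
    calc (2 / 5) ^ n / ρ ^ n = (1 / 2) ^ n * ((5 / 4 * ρ) ^ n)⁻¹ := by
          rw [mul_pow, mul_inv, ← mul_assoc, ← inv_pow, ← mul_pow, div_eq_mul_inv]
          norm_num
      _ ≤ _ := by gcongr
  calc ENNReal.ofReal (ρ / ρ ^ n)
      = ENNReal.ofReal c⁻¹ * (ENNReal.ofReal ((2 / 5) ^ n / ρ ^ n) *
          volume (Set.Ioo (1 - ρ / 4) 1)) := by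
        rw [Real.volume_Ioo, ← ENNReal.ofReal_mul (by positivity),
          ← ENNReal.ofReal_mul (by positivity)]
        congr 1
        rw [hc]
        field_simp
        ring
    _ = ENNReal.ofReal c⁻¹ * ∫⁻ r in Set.Ioo (1 - ρ / 4) 1,
          ENNReal.ofReal ((2 / 5) ^ n / ρ ^ n) := by
        rw [setLIntegral_const]
    _ ≤ _ := by
        refine mul_le_mul' le_rfl ?_
        refine (setLIntegral_mono' measurableSet_Ioo hlow).trans (lintegral_mono_set fun r hr => ?_)
        have := hr.1
        exact Set.mem_Ioi.2 (by linarith)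

end KernelBound

/-! ### The conformal weight and the bound on its kernel. -/

section Weight

variable {n : ℕ}

/-- The weight `|γ'(x)| ^ (n / 2)`. -/
noncomputable def confWeight (γ : SOPlus n) (x : S n) : ℝ := (boost γ x)⁻¹ ^ ((n : ℝ) / 2)

theorem confWeight_pos (γ : SOPlus n) (x : S n) : 0 < confWeight γ x :=
  Real.rpow_pos_of_pos (inv_pos.2 (boost_pos γ x)) _

theorem confWeight_sq (γ : SOPlus n) (x : S n) : confWeight γ x ^ 2 = (boost γ x)⁻¹ ^ n := by
  rw [confWeight, ← Real.rpow_mul_natCast (inv_pos.2 (boost_pos γ x)).le, ← Real.rpow_natCast]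
  congr 1
  push_cast
  ring

theorem confWeight_one (x : S n) : confWeight 1 x = 1 := by
  rw [confWeight, boost_one, inv_one, Real.one_rpow]

theorem confWeight_mul (γ γ' : SOPlus n) (x : S n) :
    confWeight (γ * γ') x = confWeight γ' x * confWeight γ (sphereAct γ' x) := by
  rw [confWeight, boost_mul, mul_inv, Real.mul_rpow (inv_pos.2 (boost_pos _ _)).le
    (inv_pos.2 (boost_pos _ _)).le]
  rfl

theorem confWeight_inv_sphereAct (γ : SOPlus n) (x : S n) :
    confWeight γ⁻¹ (sphereAct γ x) = (confWeight γ x)⁻¹ := by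
  have h := confWeight_mul γ⁻¹ γ x
  rw [inv_mul_cancel, confWeight_one] at h
  exact eq_inv_of_mul_eq_one_right h.symm

theorem measurable_confWeight (γ : SOPlus n) : Measurable (confWeight γ) :=
  (continuous_boost γ).measurable.inv.pow_const _

/-- The power `n / 2` of the identity `dist_sq_sphereAct`. -/
theorem dist_rpow_sphereAct (γ : SOPlus n) (x y : S n) :
    dist (sphereAct γ x) (sphereAct γ y) ^ (n : ℝ) =
      confWeight γ x * confWeight γ y * dist x y ^ (n : ℝ) := by
  have h : ∀ a : ℝ, 0 ≤ a → a ^ (n : ℝ) = (a ^ 2) ^ ((n : ℝ) / 2) := fun a ha => by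
    rw [← Real.rpow_natCast_mul ha]
    congr 1
    push_cast
    ring
  have hx := boost_pos γ x
  have hy := boost_pos γ y
  rw [h _ dist_nonneg, h _ dist_nonneg, ← dist_sq_sphereAct γ x y, confWeight, confWeight,
    ← Real.mul_rpow (by positivity) (by positivity), ← Real.mul_rpow (by positivity) (by positivity)]
  congr 1
  field_simp

/-- The boost is Lipschitz and, by compactness, bounded below, so `s = b(x) / b(y)` is within
`O(d(x, y))` of `1`. The ratio of weights is `s ^ (n / 2)`; passing to its square `s ^ n` leaves an
integer power. -/
theorem exists_abs_confWeight_div_sub_one_le (γ : SOPlus n) :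
    ∃ C : ℝ, 0 ≤ C ∧ ∀ x y, |confWeight γ y / confWeight γ x - 1| ≤ C * dist x y := by
  have : Nonempty (S n) := ⟨sphereProj 0⟩
  obtain ⟨z, -, hz⟩ := isCompact_univ.exists_isMinOn Set.univ_nonempty
    (continuous_boost γ).continuousOn
  have hz0 := boost_pos γ z
  set c := ‖timeLin (mat γ)‖ / boost γ z with hc
  have hc0 : 0 ≤ c := by positivity
  refine ⟨c * (n * (2 * c + 1) ^ (n - 1)), by positivity, fun x y => ?_⟩
  have hx := boost_pos γ x
  have hy := boost_pos γ y
  set s := boost γ x / boost γ y with hs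
  have hs0 : 0 < s := div_pos hx hy
  have hs1 : |s - 1| ≤ c * dist x y := by
    have h1 : s - 1 = (boost γ x - boost γ y) / boost γ y := by
      rw [hs]
      field_simp
    rw [h1, abs_div, abs_of_pos hy, hc, div_mul_eq_mul_div]
    exact div_le_div₀ (by positivity) (abs_boost_sub_le γ x y) hz0 (hz (Set.mem_univ y))
  have hs2 : s ≤ 2 * c + 1 := by
    have h1 := (le_abs_self _).trans hs1
    have h2 := mul_le_mul_of_nonneg_left (dist_le_two_sphere x y) hc0
    linarith
  set a := confWeight γ y / confWeight γ x with ha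
  have ha0 : 0 < a := div_pos (confWeight_pos γ y) (confWeight_pos γ x)
  have ha2 : a ^ 2 = s ^ n := by
    rw [ha, div_pow, confWeight_sq, confWeight_sq, ← div_pow, hs]
    congr 1
    field_simp
  -- Since `a > 0`, the factor `a + 1` exceeds `1`, hence `|a - 1| ≤ |a² - 1|`.
  calc |a - 1| ≤ |a - 1| * |a + 1| :=
        le_mul_of_one_le_right (abs_nonneg _) (by rw [abs_of_pos (by positivity)]; linarith)
    _ = |s ^ n - 1 ^ n| := by
        rw [← abs_mul, ← ha2, one_pow]
        congr 1
        ring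
    _ ≤ |s - 1| * n * max |s| |1| ^ (n - 1) := abs_pow_sub_pow_le _ _ _
    _ ≤ c * dist x y * n * (2 * c + 1) ^ (n - 1) := by
        gcongr
        rw [abs_of_pos hs0, abs_one]
        exact max_le hs2 (by linarith)
    _ = _ := by ring

theorem exists_lintegral_scaleKernel_le (γ : SOPlus n) :
    ∃ K : ℝ≥0, ∀ x, ∫⁻ y, ‖scaleKernel n (confWeight γ) (x, y)‖ₑ ∂(sphereMeasure n) ≤ K := by
  obtain ⟨C, hC, h⟩ := exists_abs_confWeight_div_sub_one_le γ
  obtain ⟨K, hK⟩ := exists_lintegral_dist_le n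
  refine ⟨C.toNNReal * K, fun x => ?_⟩
  calc _ ≤ ∫⁻ y, C.toNNReal * ENNReal.ofReal (dist x y / dist x y ^ n) ∂(sphereMeasure n) := by
        refine lintegral_mono fun y => ?_
        rw [← ofReal_norm, ← ENNReal.ofReal, ← ENNReal.ofReal_mul hC]
        refine ENNReal.ofReal_le_ofReal ?_
        simp only [scaleKernel, Real.rpow_natCast]
        rw [norm_div, Real.norm_of_nonneg (pow_nonneg dist_nonneg n), ← mul_div_assoc]
        exact div_le_div_of_nonneg_right (h x y) (pow_nonneg dist_nonneg n)
    _ = C.toNNReal * ∫⁻ y, ENNReal.ofReal (dist x y / dist x y ^ n) ∂(sphereMeasure n) :=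
        lintegral_const_mul' _ _ ENNReal.coe_ne_top
    _ ≤ _ := by
        rw [ENNReal.coe_mul]
        gcongr
        exact hK x

end Weight

/-! ### Density of the form domain. -/

section Density

variable {n : ℕ}

/-- The algebra of Lipschitz functions on the sphere. -/
def lipschitzSubalgebra (n : ℕ) : Subalgebra ℝ C(S n, ℝ) where
  carrier := {f | ∃ L : ℝ, ∀ x y, |f x - f y| ≤ L * dist x y}
  mul_mem' := by
    rintro f g ⟨L, hL⟩ ⟨L', hL'⟩
    refine ⟨‖f‖ * L' + ‖g‖ * L, fun x y => ?_⟩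
    have h1 : (f * g) x - (f * g) y = f x * (g x - g y) + g y * (f x - f y) := by
      simp only [ContinuousMap.mul_apply]
      ring
    have h2 : |f x| ≤ ‖f‖ := f.norm_coe_le_norm x
    have h3 : |g y| ≤ ‖g‖ := g.norm_coe_le_norm y
    calc |(f * g) x - (f * g) y| ≤ |f x| * |g x - g y| + |g y| * |f x - f y| := by
          rw [h1, ← abs_mul, ← abs_mul]
          exact abs_add_le _ _
      _ ≤ ‖f‖ * (L' * dist x y) + ‖g‖ * (L * dist x y) := by
          gcongr
          exacts [hL' x y, hL x y]
      _ = _ := by ring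
  add_mem' := by
    rintro f g ⟨L, hL⟩ ⟨L', hL'⟩
    refine ⟨L + L', fun x y => ?_⟩
    have h1 : (f + g) x - (f + g) y = (f x - f y) + (g x - g y) := by
      simp only [ContinuousMap.add_apply]
      ring
    rw [h1, add_mul]
    exact (abs_add_le _ _).trans (add_le_add (hL x y) (hL' x y))
  algebraMap_mem' := fun r => ⟨0, fun x y => by simp⟩

theorem lipschitzSubalgebra_separatesPoints (n : ℕ) :
    (lipschitzSubalgebra n).SeparatesPoints := by
  intro x y hxy
  refine ⟨fun z => dist z x, ⟨⟨fun z => dist z x, by fun_prop⟩, ⟨1, fun a b => ?_⟩, rfl⟩, ?_⟩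
  · rw [one_mul]
    exact abs_dist_sub_le a b x
  · simp only [dist_self]
    exact (dist_pos.2 hxy.symm).ne

/-- A Lipschitz constant `L` bounds the integrand by `L² d² / d ^ n ≤ 2 L² d / d ^ n`, using that
the sphere has diameter at most `2`; this is integrable by `exists_lintegral_dist_le`. -/
theorem toLp_mem_logDomain {f : C(S n, ℝ)} (hf : f ∈ lipschitzSubalgebra n) :
    ContinuousMap.toLp 2 (sphereMeasure n) ℝ f ∈ logDomain (sphereMeasure n) n := by
  obtain ⟨L, hL⟩ := hf
  obtain ⟨K, hK⟩ := exists_lintegral_dist_le n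
  have hfe := ContinuousMap.coeFn_toLp (p := 2) (𝕜 := ℝ) (sphereMeasure n) f
  have hκm : Measurable fun p : S n × S n => dist p.1 p.2 / dist p.1 p.2 ^ n := by fun_prop
  have hκ : Integrable (fun p : S n × S n => dist p.1 p.2 / dist p.1 p.2 ^ n * (2 * L ^ 2))
      ((sphereMeasure n).prod (sphereMeasure n)) := by
    refine integrable_kernel_mul hκm (K := K) (fun x => ?_) (integrable_const (2 * L ^ 2))
    refine le_of_eq_of_le (lintegral_congr fun y => ?_) (hK x)
    exact Real.enorm_of_nonneg (by positivity)
  change Integrable _ _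
  rw [integrable_congr (logIntegrand_congr _ hfe hfe)]
  refine hκ.mono (aestronglyMeasurable_logIntegrand _ f.continuous.aestronglyMeasurable
    f.continuous.aestronglyMeasurable) (Filter.Eventually.of_forall fun p => ?_)
  rw [Real.norm_of_nonneg (logIntegrand_self_nonneg _ _ _), Real.norm_of_nonneg (by positivity),
    logIntegrand, Real.rpow_natCast, div_mul_eq_mul_div]
  refine div_le_div_of_nonneg_right ?_ (by positivity)
  have h1 := hL p.1 p.2
  have h2 := dist_le_two_sphere p.1 p.2
  have h3 : 0 ≤ dist p.1 p.2 := dist_nonneg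
  calc (f p.1 - f p.2) * (f p.1 - f p.2) = |f p.1 - f p.2| ^ 2 := by rw [sq_abs, sq]
    _ ≤ (L * dist p.1 p.2) ^ 2 := by gcongr
    _ = dist p.1 p.2 * L ^ 2 * dist p.1 p.2 := by ring
    _ ≤ dist p.1 p.2 * L ^ 2 * 2 := by gcongr
    _ = _ := by ring

/-- By Stone–Weierstrass, Lipschitz functions are uniformly dense in the continuous functions, which
are dense in `L²`. -/
theorem dense_logDomain (n : ℕ) :
    Dense (logDomain (sphereMeasure n) n : Set (Lp ℝ 2 (sphereMeasure n))) := by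
  have h1 : Dense (lipschitzSubalgebra n : Set C(S n, ℝ)) := fun f =>
    ContinuousMap.continuousMap_mem_subalgebra_closure_of_separatesPoints _
      (lipschitzSubalgebra_separatesPoints n) f
  have h2 := (ContinuousMap.toLp_denseRange ℝ (sphereMeasure n) (p := 2) ℝ (by simp)).dense_image
    (ContinuousMap.toLp 2 (sphereMeasure n) ℝ).continuous h1
  refine h2.mono ?_
  rintro _ ⟨f, hf, rfl⟩
  exact toLp_mem_logDomain hf

end Density

/-! ### The unitary representation on `L²`. -/

section Representation

variable {n : ℕ}

theorem aestronglyMeasurable_weighted_comp (γ : SOPlus n) (f : Lp ℝ 2 (sphereMeasure n)) :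
    AEStronglyMeasurable (fun x => confWeight γ⁻¹ x * f (sphereAct γ⁻¹ x)) (sphereMeasure n) :=
  ((measurable_confWeight γ⁻¹).mul ((Lp.stronglyMeasurable f).measurable.comp
    (continuous_sphereAct γ⁻¹).measurable)).aestronglyMeasurable

/-- The square of the weight is the density of the change of variables `lintegral_boost` for `γ⁻¹`.
-/
theorem eLpNorm_weighted_comp (γ : SOPlus n) (f : Lp ℝ 2 (sphereMeasure n)) :
    eLpNorm (fun x => confWeight γ⁻¹ x * f (sphereAct γ⁻¹ x)) 2 (sphereMeasure n) =
      eLpNorm f 2 (sphereMeasure n) := by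
  rw [eLpNorm_eq_lintegral_rpow_enorm_toReal two_ne_zero ENNReal.ofNat_ne_top,
    eLpNorm_eq_lintegral_rpow_enorm_toReal two_ne_zero ENNReal.ofNat_ne_top]
  congr 1
  rw [← lintegral_boost γ⁻¹ (F := fun x => ‖f x‖ₑ ^ (2 : ℝ≥0∞).toReal)
    ((Lp.stronglyMeasurable f).measurable.enorm.pow_const _)]
  refine lintegral_congr fun x => ?_
  rw [enorm_mul, ENNReal.mul_rpow_of_nonneg _ _ ENNReal.toReal_nonneg, ← confWeight_sq,
    Real.enorm_of_nonneg (confWeight_pos _ _).le, ENNReal.toReal_ofNat, ENNReal.rpow_ofNat,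
    ENNReal.ofReal_pow (confWeight_pos _ _).le]

theorem memLp_weighted_comp (γ : SOPlus n) (f : Lp ℝ 2 (sphereMeasure n)) :
    MemLp (fun x => confWeight γ⁻¹ x * f (sphereAct γ⁻¹ x)) 2 (sphereMeasure n) :=
  ⟨aestronglyMeasurable_weighted_comp γ f, (eLpNorm_weighted_comp γ f).trans_lt (Lp.memLp f).2⟩

/-- The isometry `f ↦ |(γ⁻¹)'| ^ (n / 2) f ∘ γ⁻¹` of `L²(Sⁿ)`. -/
noncomputable def repIsometry (γ : SOPlus n) :
    Lp ℝ 2 (sphereMeasure n) →ₗᵢ[ℝ] Lp ℝ 2 (sphereMeasure n) where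
  toFun f := (memLp_weighted_comp γ f).toLp
  map_add' f g := by
    refine Lp.ext ?_
    filter_upwards [(memLp_weighted_comp γ (f + g)).coeFn_toLp, (memLp_weighted_comp γ f).coeFn_toLp,
      (memLp_weighted_comp γ g).coeFn_toLp, Lp.coeFn_add (memLp_weighted_comp γ f).toLp
        (memLp_weighted_comp γ g).toLp,
      (quasiMeasurePreserving_sphereAct γ⁻¹).ae (Lp.coeFn_add f g)] with x h1 h2 h3 h4 h5
    rw [h1, h4, Pi.add_apply, h2, h3, h5, Pi.add_apply, mul_add]
  map_smul' c f := by
    refine Lp.ext ?_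
    filter_upwards [(memLp_weighted_comp γ (c • f)).coeFn_toLp, (memLp_weighted_comp γ f).coeFn_toLp,
      Lp.coeFn_smul c (memLp_weighted_comp γ f).toLp,
      (quasiMeasurePreserving_sphereAct γ⁻¹).ae (Lp.coeFn_smul c f)] with x h1 h2 h3 h4
    rw [h1, RingHom.id_apply, h3, Pi.smul_apply, h2, h4, Pi.smul_apply, smul_eq_mul, smul_eq_mul,
      mul_left_comm]
  norm_map' f := by
    change ‖(memLp_weighted_comp γ f).toLp‖ = ‖f‖
    rw [Lp.norm_toLp, eLpNorm_weighted_comp, Lp.norm_def]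

theorem coeFn_repIsometry (γ : SOPlus n) (f : Lp ℝ 2 (sphereMeasure n)) :
    repIsometry γ f =ᵐ[sphereMeasure n] fun x => confWeight γ⁻¹ x * f (sphereAct γ⁻¹ x) :=
  (memLp_weighted_comp γ f).coeFn_toLp

/-- The cocycle rule of the weight; inverses reverse the order of the factors, which makes this a
left action. -/
theorem repIsometry_mul (γ γ' : SOPlus n) (f : Lp ℝ 2 (sphereMeasure n)) :
    repIsometry (γ * γ') f = repIsometry γ (repIsometry γ' f) := by
  refine Lp.ext ?_
  filter_upwards [coeFn_repIsometry (γ * γ') f, coeFn_repIsometry γ (repIsometry γ' f),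
    (quasiMeasurePreserving_sphereAct γ⁻¹).ae (coeFn_repIsometry γ' f)] with x h1 h2 h3
  rw [h1, h2, h3, mul_inv_rev, confWeight_mul, sphereAct_mul, mul_assoc]

theorem repIsometry_one (f : Lp ℝ 2 (sphereMeasure n)) : repIsometry 1 f = f := by
  refine Lp.ext ?_
  filter_upwards [coeFn_repIsometry 1 f] with x h
  rw [h, inv_one, confWeight_one, sphereAct_one, one_mul]

/-- The unitary representation of `SO⁺(n+1,1)` on `L²(Sⁿ)`. -/
noncomputable def rep (n : ℕ) :
    SOPlus n →* (Lp ℝ 2 (sphereMeasure n) ≃ₗᵢ[ℝ] Lp ℝ 2 (sphereMeasure n)) :=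
  MonoidHom.mk'
    (fun γ =>
      { toLinearEquiv := LinearEquiv.ofLinearMap (repIsometry γ).toLinearMap
          (repIsometry γ⁻¹).toLinearMap
          (LinearMap.ext fun f => by
            change repIsometry γ (repIsometry γ⁻¹ f) = f
            rw [← repIsometry_mul, mul_inv_cancel, repIsometry_one])
          (LinearMap.ext fun f => by
            change repIsometry γ⁻¹ (repIsometry γ f) = f
            rw [← repIsometry_mul, inv_mul_cancel, repIsometry_one])
        norm_map' := (repIsometry γ).norm_map })
    fun γ γ' => LinearIsometryEquiv.ext fun f => repIsometry_mul γ γ' f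

/-- The form that `logLaplacian_commutator` requires: evaluation at `γ x` replaces the weight of
`γ⁻¹` by the inverse weight of `γ`. -/
theorem rep_apply_sphereAct (γ : SOPlus n) (f : Lp ℝ 2 (sphereMeasure n)) :
    ∀ᵐ x ∂(sphereMeasure n), rep n γ f (sphereAct γ x) = (confWeight γ x)⁻¹ * f x := by
  filter_upwards [(quasiMeasurePreserving_sphereAct γ).ae (coeFn_repIsometry γ f)] with x h
  rw [← confWeight_inv_sphereAct, ← congrArg f (sphereAct_inv_sphereAct γ x)]
  exact h

end Representation

end LogLaplace

open LogLaplace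
theorem proposition5p13 (n : ℕ) (hn : 1 ≤ n) :
    ∃ U : SOPlus n →* (Lp ℝ 2 (sphereMeasure n) ≃ₗᵢ[ℝ] Lp ℝ 2 (sphereMeasure n)),
      (∀ (γ : SOPlus n) (f : Lp ℝ 2 (sphereMeasure n)),
        U γ f =ᵐ[sphereMeasure n]
          fun x => scale γ⁻¹ x ^ ((n : ℝ) / 2) * f (sphereAct γ⁻¹ x)) ∧
      ∀ γ : SOPlus n,
        (∀ f ∈ (logLaplacian (sphereMeasure n) n).domain,
          U γ f ∈ (logLaplacian (sphereMeasure n) n).domain) ∧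
        ∃ B : Lp ℝ 2 (sphereMeasure n) →L[ℝ] Lp ℝ 2 (sphereMeasure n),
          ∀ (f : (logLaplacian (sphereMeasure n) n).domain)
            (hf : U γ (f : Lp ℝ 2 (sphereMeasure n)) ∈ (logLaplacian (sphereMeasure n) n).domain),
            logLaplacian (sphereMeasure n) n ⟨U γ (f : Lp ℝ 2 (sphereMeasure n)), hf⟩ -
              U γ (logLaplacian (sphereMeasure n) n f) = B f := by
  refine ⟨rep n, fun γ f => ?_, fun γ => ?_⟩
  · simp only [scale_eq hn]
    exact coeFn_repIsometry γ f
  · obtain ⟨K, hK⟩ := exists_lintegral_scaleKernel_le γ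
    -- The conformal map is `γ` itself with `q = |γ'| ^ (n / 2)`, although `U γ` is defined through
    -- `γ⁻¹`.
    refine logLaplacian_commutator (φ := sphereEquiv γ) (dense_logDomain n)
      (measurable_confWeight γ) (confWeight_pos γ) (dist_rpow_sphereAct γ) ?_ hK (rep n γ)
      (rep_apply_sphereAct γ)
    simp only [confWeight_sq]
    exact measurePreserving_sphereEquiv γ
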